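/- **Setting.** Let $M$ be a smooth $8$-manifold with an almost quaternion-Hermitian structure $(g,\mathcal Q)$: $g$ is a Riemannian metric and $\mathcal Q\subset \mathrm{End}(TM)$ is a rank-3 subbundle locally spanned by smooth $I_1,I_2,I_3$ with $I_1I_2=-I_2I_1=I_3$, $I_s^2=-\mathrm{Id}$, $g(I_sx,I_sy)=g(x,y)$; any three endomorphisms of a tangent space that satisfy these identities and span $\mathcal Q_p$ are called admissible at $p$. Put $\omega_s(x,y)=g(I_sx,y)$ and $\Omega=\sum_{s=1}^3\omega_s\wedge\omega_s$ (a global 4-form, independent of the admissible triple). Let $Bsp(2)\subset \mathrm{End}(TM)$ be the bundle whose fibre at $p$ consists of the $g$-skew-symmetric endomorphisms of $T_pM$ that commute with $\mathcal Q_p$. An *adapted frame* at $p$ is an admissible triple $J_1,J_2,J_3$ at $p$ together with a basis $e_1,\dots,e_4$ of the $i$-eigenspace $W$ of $J_1$ in $T_pM\otimes\mathbb C$ such that $g(e_\alpha,\overline{e_\beta})=\delta_{\alpha\beta}$, $e_3=J_2\overline{e_1}$, $e_4=J_2\overline{e_2}$. A *hyper-Kähler curvature-type tensor* at $p$ is a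 4-tensor $K\in\Lambda^2T_p^*M\otimes\Lambda^2T_p^*M$ with $K(x,y,z,w)+K(y,z,x,w)+K(z,x,y,w)=0$ and $K(x,y,I_sz,I_sw)=K(x,y,z,w)$ for all $s$ and every admissible triple. An adapted frame is *normal for $K$* if the tensor $S(x,y,z,w)=\frac12\big(K(x,J_2y,z,J_2w)-K(x,J_3y,z,J_3w)\big)$ satisfies, for all $x=\sum_\alpha x_\alpha e_\alpha\in W$ $(x_\alpha\in\mathbb C)$, $$S(x,x,x,x)=-18x_1x_2x_3x_4+4\sqrt3\,x_1x_4^3-4\sqrt3\,x_2^3x_3+3x_2^2x_4^2-9x_1^2x_3^2$$ (a normalized discriminant of a cubic polynomial). A *cubic discriminant* on $M$ is a smooth 4-tensor field $K$ that at each point is a hyper-Kähler curvature-type tensor possessing a normal frame. The induced bundle $Bsp(1)_{ir}\subset Bsp(2)$ has as fibre at $p$ the set of real endomorphisms that, in a normal frame for $K$, act on $(e_\alpha)$ by a real linear combination of the matrices $$\begin{pmatrix}-\frac{3i}2&0&0&0\\0&-\frac i2&0&0\\0&0&\frac{3i}2&0\\0&0&0&\frac i2\end{pmatrix},\quad \begin{pmatrix}0&-\frac{\sqrt3}2&0&0\\\frac{\sqrt3}2&0&0&1\\0&0&0&-\frac{\sqrt3}2\\0&-1&\frac{\sqrt3}2&0\end{pmatrix},\quad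 \begin{pmatrix}0&\frac{i\sqrt3}2&0&0\\\frac{i\sqrt3}2&0&0&-i\\0&0&0&-\frac{i\sqrt3}2\\0&-i&-\frac{i\sqrt3}2&0\end{pmatrix}$$ of the irreducible representation of $sp(1)$ on $\mathbb C^4$. **Proposition.** Let $\mathcal E_1,\mathcal E_2,\mathcal E_3$ be smooth global sections of $Bsp(2)$ with $[\mathcal E_1,\mathcal E_2]=\mathcal E_3$, $[\mathcal E_2,\mathcal E_3]=\mathcal E_1$, $[\mathcal E_3,\mathcal E_1]=\mathcal E_2$, and let $\epsilon_s(x,y)=g(\mathcal E_sx,y)$. There exists a cubic discriminant $K$ on $M$ whose induced bundle $Bsp(1)_{ir}$ coincides at each point with the real linear span of $\mathcal E_1,\mathcal E_2,\mathcal E_3$ if and only if $$\sum_{s=1}^3\epsilon_s\wedge\epsilon_s=-\frac34\,\Omega .$$ When this holds, there is exactly one such cubic discriminant, and it is given at each point, for any admissible triple $I_1,I_2,I_3$ at that point, by $$K(x,y,z,w)=\sum_{s}g(\mathcal E_sx,y)g(\mathcal E_sz,w)+\frac38\big(g(x,w)g(y,z)-g(x,z)g(y,w)\big)+\frac38\sum_{s}\big(\omega_s(x,z)\omega_s(w,y)+\omega_s(x,w)\omega_s(y,z)\big).$$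 -/

import Mathlib

open Bundle Manifold Set
open scoped ContDiff

noncomputable section

/-! ### Linear algebra on one tangent space

`V` is a real vector space with an inner product `g`. Indices `s = 1, 2, 3` of triples are the
elements `0, 1, 2` of `Fin 3`, and the indices `1, …, 4` of complex frames are those of `Fin 4`. -/

set_option linter.unusedSectionVars false

namespace CubicDisc

variable {V : Type*} [AddCommGroup V] [Module ℝ V] [TopologicalSpace V] [IsTopologicalAddGroup V]
  [ContinuousSMul ℝ V]

/-- The identities `J₁ J₂ = - J₂ J₁ = J₃`, `J_s² = - Id`, `g (J_s x, J_s y) = g (x, y)`. -/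
structure IsHyperHermitian (g : V →L[ℝ] V →L[ℝ] ℝ) (J : Fin 3 → V →L[ℝ] V) : Prop where
  mul_eq : J 0 ∘L J 1 = J 2
  mul_swap_eq : J 1 ∘L J 0 = - J 2
  sq_eq : ∀ s, J s ∘L J s = - ContinuousLinearMap.id ℝ V
  isometry : ∀ s x y, g (J s x) (J s y) = g x y

/-- `I₁, I₂, I₃` are generators of the space of endomorphisms `Q` that satisfy the
quaternionic identities. -/
structure IsAdmissibleTriple (g : V →L[ℝ] V →L[ℝ] ℝ) (Q : Submodule ℝ (V →L[ℝ] V))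
    (I : Fin 3 → V →L[ℝ] V) : Prop where
  hyperHermitian : IsHyperHermitian g I
  span_eq : Submodule.span ℝ (range I) = Q

/-- The Lie algebra `sp(2)` inside `End V`: the `g`-skew-symmetric endomorphisms that commute with
every element of `Q`. -/
def sp (g : V →L[ℝ] V →L[ℝ] ℝ) (Q : Submodule ℝ (V →L[ℝ] V)) : Submodule ℝ (V →L[ℝ] V) where
  carrier := {A | (∀ x y, g (A x) y = - g x (A y)) ∧ ∀ B ∈ Q, A ∘L B = B ∘L A}
  add_mem' := by
    rintro A B ⟨hA, hA'⟩ ⟨hB, hB'⟩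
    refine ⟨fun x y => ?_, fun C hC => ?_⟩
    · simp only [add_apply, map_add, hA, hB]; ring
    · rw [ContinuousLinearMap.add_comp, ContinuousLinearMap.comp_add, hA' C hC, hB' C hC]
  zero_mem' := ⟨fun x y => by simp, fun C _ => by simp⟩
  smul_mem' := by
    rintro c A ⟨hA, hA'⟩
    refine ⟨fun x y => ?_, fun C hC => ?_⟩
    · simp only [smul_apply, map_smul, hA, smul_eq_mul]; ring
    · rw [ContinuousLinearMap.smul_comp, ContinuousLinearMap.comp_smul, hA' C hC]

/-- The bilinear form `(x, y) ↦ g (A x, y)`; it is a 2-form when `A` is skew-symmetric. -/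
def twoForm (g : V →L[ℝ] V →L[ℝ] ℝ) (A : V →L[ℝ] V) (x y : V) : ℝ := g (A x) y

/-- The wedge product of two 2-forms, evaluated on four vectors. -/
def wedge (α β : V → V → ℝ) (x y z w : V) : ℝ :=
  α x y * β z w - α x z * β y w + α x w * β y z
    + α y z * β x w - α y w * β x z + α z w * β x y

/-- `K` is a hyper-Kähler curvature-type tensor: skew-symmetric in the first two and in the last
two arguments, with the Bianchi identity, and invariant under each `J_s` in the last pair. -/
structure IsHyperKahlerCurvature (J : Fin 3 → V →L[ℝ] V)
    (K : V →ₗ[ℝ] V →ₗ[ℝ] V →ₗ[ℝ] V →ₗ[ℝ] ℝ) : Prop where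
  skew_left : ∀ x y z w, K y x z w = - K x y z w
  skew_right : ∀ x y z w, K x y w z = - K x y z w
  bianchi : ∀ x y z w, K x y z w + K y z x w + K z x y w = 0
  invariant : ∀ s x y z w, K x y (J s z) (J s w) = K x y z w

/-! #### The complexification

An element `a + i b` of the complexification of `V` is represented by the pair `(a, b)`. -/

/-- Multiplication of `a + i b` by the complex number `c`. -/
def csmul (c : ℂ) (X : V × V) : V × V :=
  (c.re • X.1 - c.im • X.2, c.re • X.2 + c.im • X.1)

/-- The complex linear extension of an endomorphism. -/
def cmap (A : V →L[ℝ] V) (X : V × V) : V × V := (A X.1, A X.2)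

/-- The complex multilinear extension of a real 4-tensor. -/
def cext (K : V →ₗ[ℝ] V →ₗ[ℝ] V →ₗ[ℝ] V →ₗ[ℝ] ℝ) (X Y Z W : V × V) : ℂ :=
  ∑ a : Fin 2, ∑ b : Fin 2, ∑ c : Fin 2, ∑ d : Fin 2,
    Complex.I ^ (a.val + b.val + c.val + d.val) *
      (K (![X.1, X.2] a) (![Y.1, Y.2] b) (![Z.1, Z.2] c) (![W.1, W.2] d) : ℂ)

/-- The totally symmetric tensor `S` that corresponds to a hyper-Kähler curvature-type tensor `K`,
`S (x, y, z, w) = ½ (K (x, J₂ y, z, J₂ w) - K (x, J₃ y, z, J₃ w))`, extended to complex vectors. -/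
def symTensor (J : Fin 3 → V →L[ℝ] V) (K : V →ₗ[ℝ] V →ₗ[ℝ] V →ₗ[ℝ] V →ₗ[ℝ] ℝ)
    (X Y Z W : V × V) : ℂ :=
  (1 / 2) * (cext K X (cmap (J 1) Y) Z (cmap (J 1) W) - cext K X (cmap (J 2) Y) Z (cmap (J 2) W))

/-- The vector `(f - i J₁ f) / √2` of the `i`-eigenspace of `J₁` in the complexification. -/
def toW (J : Fin 3 → V →L[ℝ] V) (f : V) : V × V :=
  ((√2)⁻¹ • f, -((√2)⁻¹ • J 0 f))

/-- `J` and `f` give an `Sp(2)Sp(1)`-frame: `J` is an admissible triple, and the vectors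
`e_α = (f_α - i J₁ f_α) / √2` satisfy `g (e_α, ē_β) = δ_{αβ}`, `e₃ = J₂ ē₁` and `e₄ = J₂ ē₂`,
i.e. they form an `Sp(2)`-adapted basis of the `i`-eigenspace of `J₁`. -/
structure IsAdaptedFrame (g : V →L[ℝ] V →L[ℝ] ℝ) (Q : Submodule ℝ (V →L[ℝ] V))
    (J : Fin 3 → V →L[ℝ] V) (f : Fin 4 → V) : Prop where
  triple : IsAdmissibleTriple g Q J
  three_eq : f 2 = J 1 (f 0)
  four_eq : f 3 = J 1 (f 1)
  orthonormal : ∀ α β, g (f α) (f β) = if α = β then 1 else 0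
  orthogonal : ∀ α β, g (J 0 (f α)) (f β) = 0

/-- The discriminant of a cubic polynomial as a quartic form, in the normalization that is used on
`Sp(2)`-adapted bases: with `x₁ = a`, `x₂ = b / √3`, `x₃ = d`, `x₄ = -c / √3` it is one third of
the discriminant of the cubic `a t³ + b t² + c t + d`. -/
def discForm (x : Fin 4 → ℂ) : ℂ :=
  -18 * x 0 * x 1 * x 2 * x 3 + 4 * (√3 : ℝ) * x 0 * x 3 ^ 3 - 4 * (√3 : ℝ) * x 1 ^ 3 * x 2
    + 3 * x 1 ^ 2 * x 3 ^ 2 - 9 * x 0 ^ 2 * x 2 ^ 2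

/-- The frame `(J, f)` is adapted to `(g, Q)`, and in its complex coordinates the symmetric tensor
of `K` is the discriminant of a cubic polynomial. -/
structure IsCubicFrame (g : V →L[ℝ] V →L[ℝ] ℝ) (Q : Submodule ℝ (V →L[ℝ] V))
    (K : V →ₗ[ℝ] V →ₗ[ℝ] V →ₗ[ℝ] V →ₗ[ℝ] ℝ) (J : Fin 3 → V →L[ℝ] V) (f : Fin 4 → V) : Prop where
  adapted : IsAdaptedFrame g Q J f
  normal_form : ∀ x : Fin 4 → ℂ,
    symTensor J K (∑ α, csmul (x α) (toW J (f α))) (∑ α, csmul (x α) (toW J (f α)))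
      (∑ α, csmul (x α) (toW J (f α))) (∑ α, csmul (x α) (toW J (f α))) = discForm x

/-- The orbit of cubic discriminants: the hyper-Kähler curvature-type tensors whose symmetric
tensor is the discriminant of a cubic polynomial in some adapted frame. -/
def cubicDiscriminants (g : V →L[ℝ] V →L[ℝ] ℝ) (Q : Submodule ℝ (V →L[ℝ] V)) :
    Set (V →ₗ[ℝ] V →ₗ[ℝ] V →ₗ[ℝ] V →ₗ[ℝ] ℝ) :=
  {K | (∀ J, IsAdmissibleTriple g Q J → IsHyperKahlerCurvature J K) ∧
    ∃ J f, IsCubicFrame g Q K J f}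

/-- The matrices of the standard basis of `sp(1)` in its irreducible representation
on `ℂ⁴ = S³ ℂ²`. -/
def irMatrix : Fin 3 → Matrix (Fin 4) (Fin 4) ℂ :=
  ![!![-(3 / 2) * Complex.I, 0, 0, 0;
       0, -(1 / 2) * Complex.I, 0, 0;
       0, 0, (3 / 2) * Complex.I, 0;
       0, 0, 0, (1 / 2) * Complex.I],
    !![0, -((√3 : ℝ) / 2), 0, 0;
       (√3 : ℝ) / 2, 0, 0, 1;
       0, 0, 0, -((√3 : ℝ) / 2);
       0, -1, (√3 : ℝ) / 2, 0],
    !![0, (√3 : ℝ) / 2 * Complex.I, 0, 0;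
       (√3 : ℝ) / 2 * Complex.I, 0, 0, -Complex.I;
       0, 0, 0, -((√3 : ℝ) / 2 * Complex.I);
       0, -Complex.I, -((√3 : ℝ) / 2 * Complex.I), 0]]

/-- The fibre of `Bsp(1)_ir`: all real endomorphisms `A` that, in some frame in which `K` has the
normal form, act on the basis `e_α` by a real linear combination of the matrices `irMatrix`. -/
def spOneIr (g : V →L[ℝ] V →L[ℝ] ℝ) (Q : Submodule ℝ (V →L[ℝ] V))
    (K : V →ₗ[ℝ] V →ₗ[ℝ] V →ₗ[ℝ] V →ₗ[ℝ] ℝ) : Set (V →L[ℝ] V) :=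
  {A | ∃ J f, IsCubicFrame g Q K J f ∧ ∃ a : Fin 3 → ℝ, ∀ β,
    cmap A (toW J (f β)) = ∑ α, csmul (∑ s, (a s : ℂ) * irMatrix s α β) (toW J (f α))}

theorem IsHyperHermitian.anticomm {g : V →L[ℝ] V →L[ℝ] ℝ} {J : Fin 3 → V →L[ℝ] V}
    (hJ : IsHyperHermitian g J) (s t : Fin 3) (v : V) :
    J s (J t v) + J t (J s v) = (if s = t then (-2 : ℝ) else 0) • v := by
  have hsq : ∀ s v, J s (J s v) = -v := fun s v => by
    simpa using congrArg (fun A : V →L[ℝ] V => A v) (hJ.sq_eq s)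
  have h01 : ∀ v, J 0 (J 1 v) = J 2 v := fun v => congrArg (fun A : V →L[ℝ] V => A v) hJ.mul_eq
  have h10 : ∀ v, J 1 (J 0 v) = - J 2 v := fun v => by
    simpa using congrArg (fun A : V →L[ℝ] V => A v) hJ.mul_swap_eq
  have h02 : ∀ v, J 0 (J 2 v) = - J 1 v := fun v => by rw [← h01, hsq]
  have h20 : ∀ v, J 2 (J 0 v) = J 1 v := fun v => by
    rw [← h01, h10, map_neg, h02, neg_neg]
  have h12 : ∀ v, J 1 (J 2 v) = J 0 v := fun v => by
    have := h10 (J 0 v)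
    rw [hsq, map_neg, h20] at this
    have h' := hsq 1 (J 0 v)
    rw [h10, map_neg] at h'
    exact neg_injective h'
  have h21 : ∀ v, J 2 (J 1 v) = - J 0 v := fun v => by rw [← h01, hsq, map_neg]
  fin_cases s <;> fin_cases t <;>
    simp [hsq, h01, h10, h02, h20, h12, h21] <;> module

/-- Two admissible triples of the same `Q` have the same `∑ s, ω_s ⊗ ω_s`. -/
theorem IsAdmissibleTriple.sum_eq {g : V →L[ℝ] V →L[ℝ] ℝ} {Q : Submodule ℝ (V →L[ℝ] V)}
    {I J : Fin 3 → V →L[ℝ] V} (hI : IsAdmissibleTriple g Q I) (hJ : IsAdmissibleTriple g Q J)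
    (x y z w : V) :
    ∑ s, twoForm g (J s) x y * twoForm g (J s) z w
      = ∑ s, twoForm g (I s) x y * twoForm g (I s) z w := by
  by_cases hV : ∃ v : V, v ≠ 0
  swap
  · push Not at hV
    simp [twoForm, hV x]
  obtain ⟨v, hv⟩ := hV
  have hmem : ∀ s, ∃ c : Fin 3 → ℝ, ∑ t, c t • I t = J s := fun s => by
    have : J s ∈ Submodule.span ℝ (range I) := by
      rw [hI.span_eq, ← hJ.span_eq]
      exact Submodule.subset_span ⟨s, rfl⟩
    exact (Submodule.mem_span_range_iff_exists_fun ℝ).1 this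
  choose a ha using hmem
  have haa : ∀ s u, J s u = ∑ t, a s t • I t u := fun s u => by
    rw [← ha s]; simp
  have hA : Matrix.of a * (Matrix.of a).transpose = 1 := by
    ext s t
    have h1 := hJ.hyperHermitian.anticomm s t v
    have h2 := fun p q => hI.hyperHermitian.anticomm p q v
    have h3 : J s (J t v) + J t (J s v)
        = ∑ p, ∑ q, (a s p * a t q) • (I p (I q v) + I q (I p v)) := by
      simp only [haa, map_sum, map_smul, smul_add, Finset.sum_add_distrib, Finset.smul_sum,
        smul_smul]
      congr 1
      rw [Finset.sum_comm]
      refine Finset.sum_congr rfl fun p _ => Finset.sum_congr rfl fun q _ => ?_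
      rw [mul_comm]
    simp only [h2, h1] at h3
    simp only [smul_smul, ← Finset.sum_smul] at h3
    have h4 := smul_left_injective ℝ hv h3
    simp only [mul_ite, mul_zero, Finset.sum_ite_eq, Finset.mem_univ, if_true] at h4
    simp only [Matrix.mul_apply, Matrix.transpose_apply, Matrix.of_apply, Matrix.one_apply]
    rw [← Finset.sum_mul] at h4
    split_ifs at h4 ⊢ <;> linarith
  have hB : (Matrix.of a).transpose * Matrix.of a = 1 := mul_eq_one_comm.1 hA
  have hB' : ∀ p q, ∑ s, a s p * a s q = if p = q then 1 else 0 := fun p q => by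
    have := congrFun (congrFun hB p) q
    simpa [Matrix.mul_apply, Matrix.one_apply] using this
  have hf : ∀ s u v', twoForm g (J s) u v' = ∑ t, a s t * twoForm g (I t) u v' := fun s u v' => by
    simp [twoForm, haa]
  simp only [hf, Finset.sum_mul_sum]
  rw [Finset.sum_comm]
  refine Finset.sum_congr rfl fun p _ => ?_
  rw [Finset.sum_comm]
  have : ∀ q, ∑ s, a s p * twoForm g (I p) x y * (a s q * twoForm g (I q) z w)
      = (if p = q then 1 else 0) * (twoForm g (I p) x y * twoForm g (I q) z w) := fun q => by
    rw [← hB', Finset.sum_mul]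
    exact Finset.sum_congr rfl fun s _ => by ring
  simp [this]

end CubicDisc

/-! ### Almost quaternion-Hermitian 8-manifolds -/

/-- The model space of 8-manifolds. -/
abbrev E8 := EuclideanSpace ℝ (Fin 8)

section Manifold

variable {M : Type*} [TopologicalSpace M] [ChartedSpace E8 M] [IsManifold (𝓡 8) ∞ M]

variable (M) in
/-- Fields of endomorphisms of the tangent spaces. -/
abbrev EndField := ∀ x : M, TangentSpace (𝓡 8) x →L[ℝ] TangentSpace (𝓡 8) x

variable (M) in
/-- Fields of covariant 4-tensors. -/
abbrev FourTensorField := ∀ x : M, TangentSpace (𝓡 8) x →ₗ[ℝ] TangentSpace (𝓡 8) x →ₗ[ℝ]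
  TangentSpace (𝓡 8) x →ₗ[ℝ] TangentSpace (𝓡 8) x →ₗ[ℝ] ℝ

/-- A vector field is smooth on `U`. -/
def SmoothVectorOn (X : ∀ x : M, TangentSpace (𝓡 8) x) (U : Set M) : Prop :=
  ContMDiffOn (𝓡 8) ((𝓡 8).prod 𝓘(ℝ, E8)) ∞
    (fun x => TotalSpace.mk' E8 (E := fun x : M => TangentSpace (𝓡 8) x) x (X x)) U

/-- A field of endomorphisms is smooth on `U`, as a section of `End (TM)`. -/
def SmoothEndOn (A : EndField M) (U : Set M) : Prop :=
  ContMDiffOn (𝓡 8) ((𝓡 8).prod 𝓘(ℝ, E8 →L[ℝ] E8)) ∞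
    (fun x => TotalSpace.mk' (E8 →L[ℝ] E8)
      (E := fun x : M => TangentSpace (𝓡 8) x →L[ℝ] TangentSpace (𝓡 8) x) x (A x)) U

/-- A covariant 4-tensor field is smooth: its value on any smooth local vector fields is a smooth
function. -/
def SmoothFourTensor (K : FourTensorField M) : Prop :=
  ∀ U : Set M, IsOpen U → ∀ X Y Z W : ∀ x : M, TangentSpace (𝓡 8) x,
    SmoothVectorOn X U → SmoothVectorOn Y U → SmoothVectorOn Z U → SmoothVectorOn W U →
      ContMDiffOn (𝓡 8) 𝓘(ℝ, ℝ) ∞ (fun x => K x (X x) (Y x) (Z x) (W x)) U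

variable (M) in
/-- An almost quaternion-Hermitian structure on an 8-manifold: a Riemannian metric and a rank 3
subbundle `Q` of `End (TM)` that is locally spanned by smooth `I₁, I₂, I₃` with the quaternionic
identities. -/
structure AlmostQuaternionHermitian where
  metric : ContMDiffRiemannianMetric (𝓡 8) ∞ E8 (fun x : M => TangentSpace (𝓡 8) x)
  Q : ∀ x : M, Submodule ℝ (TangentSpace (𝓡 8) x →L[ℝ] TangentSpace (𝓡 8) x)
  locally_spanned : ∀ p : M, ∃ U : Set M, IsOpen U ∧ p ∈ U ∧ ∃ I : Fin 3 → EndField M,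
    (∀ s, SmoothEndOn (I s) U) ∧
      ∀ x ∈ U, CubicDisc.IsAdmissibleTriple (metric.inner x) (Q x) (fun s => I s x)

namespace AlmostQuaternionHermitian

variable (S : AlmostQuaternionHermitian M)

/-- `I₁, I₂, I₃` are generators of `Q` at `x` that satisfy the quaternionic identities. -/
def IsTripleAt (x : M) (I : Fin 3 → TangentSpace (𝓡 8) x →L[ℝ] TangentSpace (𝓡 8) x) : Prop :=
  CubicDisc.IsAdmissibleTriple (S.metric.inner x) (S.Q x) I

theorem exists_isTripleAt (x : M) : ∃ I, S.IsTripleAt x I := by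
  obtain ⟨U, -, hx, I, -, h⟩ := S.locally_spanned x
  exact ⟨_, h x hx⟩

/-- The 2-form `(y, z) ↦ g (A y, z)` at `x`. -/
def form (x : M) (A : TangentSpace (𝓡 8) x →L[ℝ] TangentSpace (𝓡 8) x) :
    TangentSpace (𝓡 8) x → TangentSpace (𝓡 8) x → ℝ :=
  CubicDisc.twoForm (S.metric.inner x) A

/-- The fundamental 4-form `Ω = ∑ s, ω_s ∧ ω_s`, with `ω_s (y, z) = g (I_s y, z)`; it does not
depend on the choice of the triple, see `fundamentalForm_eq`. -/
def fundamentalForm (x : M) (a b c d : TangentSpace (𝓡 8) x) : ℝ :=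
  ∑ s, CubicDisc.wedge (S.form x ((S.exists_isTripleAt x).choose s))
    (S.form x ((S.exists_isTripleAt x).choose s)) a b c d

theorem fundamentalForm_eq {x : M}
    {I : Fin 3 → TangentSpace (𝓡 8) x →L[ℝ] TangentSpace (𝓡 8) x} (hI : S.IsTripleAt x I)
    (a b c d : TangentSpace (𝓡 8) x) :
    S.fundamentalForm x a b c d
      = ∑ s, CubicDisc.wedge (S.form x (I s)) (S.form x (I s)) a b c d := by
  have h := CubicDisc.IsAdmissibleTriple.sum_eq hI (S.exists_isTripleAt x).choose_spec
  simp only [fundamentalForm, CubicDisc.wedge, Finset.sum_add_distrib, Finset.sum_sub_distrib]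
  simp only [form]
  rw [h a b c d, h a c b d, h a d b c, h b c a d, h b d a c, h c d a b]

/-- The fibre at `x` of the bundle `Bsp(2)`. -/
def Bsp2 (x : M) : Submodule ℝ (TangentSpace (𝓡 8) x →L[ℝ] TangentSpace (𝓡 8) x) :=
  CubicDisc.sp (S.metric.inner x) (S.Q x)

/-- A cubic discriminant on the manifold: a smooth 4-tensor field with values in the orbits of
cubic discriminants. -/
def IsCubicDiscriminant (K : FourTensorField M) : Prop :=
  SmoothFourTensor K ∧ ∀ x, K x ∈ CubicDisc.cubicDiscriminants (S.metric.inner x) (S.Q x)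

/-- The fibre at `x` of the bundle `Bsp(1)_ir` induced by `K`. -/
def Bsp1ir (K : FourTensorField M) (x : M) :
    Set (TangentSpace (𝓡 8) x →L[ℝ] TangentSpace (𝓡 8) x) :=
  CubicDisc.spOneIr (S.metric.inner x) (S.Q x) (K x)

end AlmostQuaternionHermitian

end Manifold

end

/-!
The statement is reduced to linear algebra on one tangent space `V` of dimension 8, together with
the smoothness of an explicit tensor.

Let `A₁, A₂, A₃` act on an adapted frame by the matrices of the irreducible representation, and let
`curvTensor` be the tensor of the asserted formula. In the complex coordinates of the frame one
checks that `∑ α_s ∧ α_s = - 3/4 Ω` (`IsIrreducibleIn.sum_wedge`). This identity is exactly the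
Bianchi identity of `curvTensor` (`curvTensor_isHyperKahlerCurvature`). The constant part of
`curvTensor` does not contribute to the quartic form on the `i`-eigenspace of `J₁`, which is the
sum of the squares of the three moment maps (`symTensor_curvTensor`), and this sum is the
discriminant (`IsIrreducibleIn.sum_sq_moment_eq_discForm`). A hyper-Kähler curvature-type tensor is
determined by its quartic form (`IsHyperKahlerCurvature.eq_zero`, by polarization and the type of
`K` with respect to `J₁`). Hence every tensor with a normal frame is the `curvTensor` of the `A_s` of
this frame (`IsIrreducibleIn.eq_curvTensor`).

If the algebra of a cubic discriminant is the span of the `E_s`, then the `A_s` and the `E_s` are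
two bases of one algebra with the same brackets, so they differ by a rotation and
`∑ α_s ⊗ α_s = ∑ ε_s ⊗ ε_s` (`sum_twoForm_eq_of_bracket`). This gives the wedge condition and the
formula for `K`. Conversely, `∑ ε_s ⊗ ε_s` determines the span (`IsIrreducibleIn.span_eq`), so
that all normal frames of `curvTensor` give the same algebra.

It remains to find a frame when the wedge condition holds
(`IsSpOneTriple.exists_isIrreducibleIn`). Evaluated on `v, J₁ v, J₂ v, J₃ v`, the condition says that
`∑_{s,t} g (E_s v, J_t v)² = 9/4 |v|⁴`. The endomorphism `J₁ E₁` is self-adjoint and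
`E₃ - J₁ E₂` raises its eigenvalues by one; for an eigenvector of the largest eigenvalue `l` the
identity together with Bessel's inequality forces `l = 3/2`. Such a vector `v`, the vector
`2/√3 E₂ v` and their images under `J₂` are the frame. The action is then determined up to one
complex structure constant, which has modulus one by the same identity and is normalized by the
phase of `v`.
-/

noncomputable section

namespace CubicDisc

variable {V : Type*} [AddCommGroup V] [Module ℝ V] [TopologicalSpace V] [IsTopologicalAddGroup V]
  [ContinuousSMul ℝ V]

set_option linter.unusedSectionVars false
-- The default depth does not suffice for the additive group structure on 4-linear maps.
set_option maxSynthPendingDepth 3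

/-! ### Quaternionic identities -/

namespace IsHyperHermitian

variable {g : V →L[ℝ] V →L[ℝ] ℝ} {J : Fin 3 → V →L[ℝ] V}

theorem sq_apply (hJ : IsHyperHermitian g J) (s : Fin 3) (v : V) : J s (J s v) = -v := by
  simpa using congrArg (fun A : V →L[ℝ] V => A v) (hJ.sq_eq s)

theorem apply_zero_one (hJ : IsHyperHermitian g J) (v : V) : J 0 (J 1 v) = J 2 v :=
  congrArg (fun A : V →L[ℝ] V => A v) hJ.mul_eq

theorem apply_one_zero (hJ : IsHyperHermitian g J) (v : V) : J 1 (J 0 v) = -J 2 v := by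
  simpa using congrArg (fun A : V →L[ℝ] V => A v) hJ.mul_swap_eq

theorem apply_zero_two (hJ : IsHyperHermitian g J) (v : V) : J 0 (J 2 v) = -J 1 v := by
  rw [← hJ.apply_zero_one, hJ.sq_apply]

theorem apply_two_zero (hJ : IsHyperHermitian g J) (v : V) : J 2 (J 0 v) = J 1 v := by
  rw [← hJ.apply_zero_one, hJ.apply_one_zero, map_neg, hJ.apply_zero_two, neg_neg]

theorem apply_two_one (hJ : IsHyperHermitian g J) (v : V) : J 2 (J 1 v) = -J 0 v := by
  rw [← hJ.apply_zero_one, hJ.sq_apply, map_neg]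

theorem apply_one_two (hJ : IsHyperHermitian g J) (v : V) : J 1 (J 2 v) = J 0 v := by
  have h := hJ.apply_one_zero (J 1 v)
  rw [hJ.apply_zero_one, hJ.apply_two_one, neg_neg] at h
  exact h

theorem skew (hJ : IsHyperHermitian g J) (s : Fin 3) (x y : V) : g (J s x) y = -g x (J s y) := by
  have h := hJ.isometry s x (J s y)
  rw [hJ.sq_apply, map_neg] at h
  linarith

end IsHyperHermitian

/-! ### Hyper-Kähler curvature-type tensors -/

namespace IsHyperKahlerCurvature

variable {g : V →L[ℝ] V →L[ℝ] ℝ} {J : Fin 3 → V →L[ℝ] V}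
  {K : V →ₗ[ℝ] V →ₗ[ℝ] V →ₗ[ℝ] V →ₗ[ℝ] ℝ}

theorem pair_symm (hK : IsHyperKahlerCurvature J K) (x y z w : V) : K x y z w = K z w x y := by
  have b := hK.bianchi
  have l := hK.skew_left
  have r := hK.skew_right
  linarith [b x y z w, b y z w x, b z w x y, b w x y z, r x y z w, r y z w x, r z x w y,
    l z x y w, l w y z x, r w y z x, l y w x z, r y w x z, r z w x y, l x z w y, r x z w y,
    l w x y z, r w x y z, l y w z x, r y w z x, l x z y w, r x y w z, l w z x y, l y z w x,
    l y x z w, r x w y z, l x w z y, r z y w x, l z y x w]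

theorem apply_right (hJ : IsHyperHermitian g J) (hK : IsHyperKahlerCurvature J K) (s : Fin 3)
    (x y z w : V) : K x y (J s z) w = -K x y z (J s w) := by
  have h := hK.invariant s x y z (J s w)
  rw [hJ.sq_apply, map_neg] at h
  linarith

theorem apply_left (hJ : IsHyperHermitian g J) (hK : IsHyperKahlerCurvature J K) (s : Fin 3)
    (x y z w : V) : K (J s x) y z w = -K x (J s y) z w := by
  rw [hK.pair_symm, hK.apply_right hJ, hK.pair_symm x]

theorem sub {K' : V →ₗ[ℝ] V →ₗ[ℝ] V →ₗ[ℝ] V →ₗ[ℝ] ℝ} (hK : IsHyperKahlerCurvature J K)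
    (hK' : IsHyperKahlerCurvature J K') : IsHyperKahlerCurvature J (K - K') where
  skew_left x y z w := by
    simp only [LinearMap.sub_apply, hK.skew_left x, hK'.skew_left x]; ring
  skew_right x y z w := by
    simp only [LinearMap.sub_apply, hK.skew_right x y z, hK'.skew_right x y z]; ring
  bianchi x y z w := by
    simp only [LinearMap.sub_apply]
    linarith [hK.bianchi x y z w, hK'.bianchi x y z w]
  invariant s x y z w := by
    simp only [LinearMap.sub_apply, hK.invariant, hK'.invariant]

/-- The vectors `(v, - J₁ v)` and `(y, J₁ y)` are those of the `i`- and the `-i`-eigenspace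
of `J₁`. -/
theorem cext_eigenvectors (hJ : IsHyperHermitian g J) (hK : IsHyperKahlerCurvature J K)
    (x y z w : V) :
    cext K (x, -J 0 x) (y, J 0 y) (z, -J 0 z) (w, J 0 w)
      = ((4 * (K x y z w - K x (J 0 y) z (J 0 w)) : ℝ) : ℂ)
        + ((4 * (K x (J 0 y) z w + K x y z (J 0 w)) : ℝ) : ℂ) * Complex.I := by
  have h2 := Complex.I_sq
  have h3 := Complex.I_pow_three
  have h4 := Complex.I_pow_four
  simp only [cext, Fin.sum_univ_two, Matrix.cons_val_zero, Matrix.cons_val_one, map_neg,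
    LinearMap.neg_apply, hK.apply_left hJ, hK.apply_right hJ, hJ.sq_apply, Fin.val_zero,
    Fin.val_one, neg_neg]
  push_cast
  norm_num only [pow_zero, pow_one, h2, h3, h4]
  ring

/-- The quartic form of `K` on the `i`-eigenspace of `J₁`, in real terms. -/
theorem symTensor_diag (hJ : IsHyperHermitian g J) (hK : IsHyperKahlerCurvature J K) (v : V) :
    symTensor J K (v, -J 0 v) (v, -J 0 v) (v, -J 0 v) (v, -J 0 v)
      = ((4 * (K v (J 1 v) v (J 1 v) - K v (J 2 v) v (J 2 v)) : ℝ) : ℂ)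
        + ((8 * K v (J 1 v) v (J 2 v) : ℝ) : ℂ) * Complex.I := by
  have e1 : cmap (J 1) (v, -J 0 v) = (J 1 v, J 0 (J 1 v)) := by
    simp [cmap, hJ.apply_one_zero, hJ.apply_zero_one]
  have e2 : cmap (J 2) (v, -J 0 v) = (J 2 v, J 0 (J 2 v)) := by
    simp [cmap, hJ.apply_two_zero, hJ.apply_zero_two]
  rw [symTensor, e1, e2, hK.cext_eigenvectors hJ, hK.cext_eigenvectors hJ]
  simp only [hJ.apply_zero_one, hJ.apply_zero_two, map_neg, LinearMap.neg_apply, neg_neg,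
    hK.pair_symm v (J 2 v) v (J 1 v)]
  push_cast
  ring

end IsHyperKahlerCurvature

/-- Polarization: a symmetric 4-linear form that vanishes on the diagonal is zero. -/
theorem eq_zero_of_symm_of_diag {V : Type*} [AddCommGroup V] {T : V → V → V → V → ℝ}
    (hadd : ∀ x x' y z w, T (x + x') y z w = T x y z w + T x' y z w)
    (h12 : ∀ x y z w, T x y z w = T y x z w) (h23 : ∀ x y z w, T x y z w = T x z y w)
    (h34 : ∀ x y z w, T x y z w = T x y w z) (h0 : ∀ x, T x x x x = 0) (x y z w : V) :
    T x y z w = 0 := by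
  have a2 : ∀ x y y' z w, T x (y + y') z w = T x y z w + T x y' z w := fun x y y' z w => by
    rw [h12, hadd, h12, h12 y']
  have a3 : ∀ x y z z' w, T x y (z + z') w = T x y z w + T x y z' w := fun x y z z' w => by
    rw [h23, a2, h23, h23 x z']
  have a4 : ∀ x y z w w', T x y z (w + w') = T x y z w + T x y z w' := fun x y z w w' => by
    rw [h34, a3, h34, h34 x y w']
  have n1 : ∀ x y z w, T (-x) y z w = -T x y z w := fun x y z w => by
    have h := hadd x (-x) y z w
    have h' := hadd 0 0 y z w
    simp only [add_neg_cancel, add_zero] at h h'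
    linarith
  have n2 : ∀ x y z w, T x (-y) z w = -T x y z w := fun x y z w => by rw [h12, n1, h12]
  have n3 : ∀ x y z w, T x y (-z) w = -T x y z w := fun x y z w => by rw [h23, n2, h23]
  have n4 : ∀ x y z w, T x y z (-w) = -T x y z w := fun x y z w => by rw [h34, n3, h34]
  have hxxyy : ∀ x y, T x x y y = 0 := fun x y => by
    have hp := h0 (x + y)
    have hm := h0 (x + -y)
    simp only [hadd, a2, a3, a4, n1, n2, n3, n4, h0] at hp hm
    have e1 : T x y x y = T x x y y := h23 _ _ _ _
    have e2 : T x y y x = T x x y y := by rw [h34, e1]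
    have e3 : T y x x y = T x x y y := by rw [h12, e1]
    have e4 : T y x y x = T x x y y := by rw [h12, e2]
    have e5 : T y y x x = T x x y y := by rw [h23, e4]
    linarith
  have hxzyy : ∀ x z y, T x z y y = 0 := fun x z y => by
    have h := hxxyy (x + z) y
    simp only [hadd, a2, hxxyy] at h
    linarith [h12 x z y y]
  have h := hxzyy x y (z + w)
  simp only [a3, a4, hxzyy] at h
  linarith [h34 x y z w]

/-- A hyper-Kähler curvature-type tensor is determined by its quartic form on the `i`-eigenspace
of `J₁`. -/
theorem IsHyperKahlerCurvature.eq_zero {g : V →L[ℝ] V →L[ℝ] ℝ} {J : Fin 3 → V →L[ℝ] V}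
    {K : V →ₗ[ℝ] V →ₗ[ℝ] V →ₗ[ℝ] V →ₗ[ℝ] ℝ} (hJ : IsHyperHermitian g J)
    (hK : IsHyperKahlerCurvature J K)
    (h0 : ∀ v, K v (J 1 v) v (J 1 v) - K v (J 2 v) v (J 2 v) = 0) : K = 0 := by
  have l := hK.apply_left hJ
  have r := hK.apply_right hJ
  have hT : ∀ x y z w, K x (J 1 y) z (J 1 w) - K x (J 2 y) z (J 2 w) = 0 := by
    refine eq_zero_of_symm_of_diag (fun x x' y z w => ?_) (fun x y z w => ?_) (fun x y z w => ?_)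
      (fun x y z w => ?_) h0
    · simp only [map_add, LinearMap.add_apply]; ring
    · rw [hK.skew_left _ x, hK.skew_left _ x, l, l]; ring
    · have hb : ∀ s, K x (J s y) z (J s w) - K x (J s z) y (J s w) = -K z y x w := fun s => by
        have h := hK.bianchi y (J s x) z (J s w)
        rw [hK.invariant] at h
        linarith [l s y x z (J s w), l s x z y (J s w), hK.skew_left (J s y) x z (J s w),
          hK.skew_left z (J s x) y (J s w), l s z x y (J s w), hK.skew_left (J s z) x y (J s w)]
      linarith [hb 1, hb 2]
    · linarith [hK.skew_right x (J 1 y) (J 1 w) z, hK.skew_right x (J 2 y) (J 2 w) z,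
        r 1 x (J 1 y) w z, r 2 x (J 2 y) w z]
  -- The form vanishes also after `J₁` is applied to its first argument.
  have hrot : ∀ x y z w, K x (J 0 y) z w = -K x y z (J 0 w) := fun x y z w => by
    have h := hT (J 0 x) (J 1 y) z (J 1 w)
    simp only [l, hJ.sq_apply, hJ.apply_two_one, map_neg, neg_neg, LinearMap.neg_apply] at h
    linarith
  ext x y z w
  have h1 := hrot x (J 0 y) z w
  have h2 := hrot x (J 0 y) w z
  simp only [hJ.sq_apply, map_neg, LinearMap.neg_apply] at h1 h2
  have h3 := r 0 x (J 0 y) z w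
  have h4 := hK.skew_right x (J 0 y) w (J 0 z)
  have h5 := hK.skew_right x y z w
  simp only [LinearMap.zero_apply]
  linarith

/-! ### The tensor of three sections of `sp(2)` -/

/-- A 4-linear map from a function that is linear in each argument. -/
def mkFour (F : V → V → V → V → ℝ)
    (a1 : ∀ x x' y z w, F (x + x') y z w = F x y z w + F x' y z w)
    (m1 : ∀ (c : ℝ) x y z w, F (c • x) y z w = c * F x y z w)
    (a2 : ∀ x y y' z w, F x (y + y') z w = F x y z w + F x y' z w)
    (m2 : ∀ (c : ℝ) x y z w, F x (c • y) z w = c * F x y z w)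
    (a3 : ∀ x y z z' w, F x y (z + z') w = F x y z w + F x y z' w)
    (m3 : ∀ (c : ℝ) x y z w, F x y (c • z) w = c * F x y z w)
    (a4 : ∀ x y z w w', F x y z (w + w') = F x y z w + F x y z w')
    (m4 : ∀ (c : ℝ) x y z w, F x y z (c • w) = c * F x y z w) :
    V →ₗ[ℝ] V →ₗ[ℝ] V →ₗ[ℝ] V →ₗ[ℝ] ℝ :=
  LinearMap.mk₂ ℝ
    (fun x y => LinearMap.mk₂ ℝ (F x y) (a3 x y) (fun c => m3 c x y) (a4 x y)
      (fun c => m4 c x y))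
    (fun x x' y => by ext z w; exact a1 x x' y z w) (fun c x y => by ext z w; exact m1 c x y z w)
    (fun x y y' => by ext z w; exact a2 x y y' z w) (fun c x y => by ext z w; exact m2 c x y z w)

/-- The tensor `∑ ε_s ⊗ ε_s` plus `3/8` of the constant tensor of `(g, I)` that restores the
Bianchi identity, with `ε_s (x, y) = g (E_s x, y)`. -/
def curvTensor (g : V →L[ℝ] V →L[ℝ] ℝ) (I E : Fin 3 → V →L[ℝ] V) :
    V →ₗ[ℝ] V →ₗ[ℝ] V →ₗ[ℝ] V →ₗ[ℝ] ℝ :=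
  mkFour (fun a b c d => (∑ s, twoForm g (E s) a b * twoForm g (E s) c d)
      + 3 / 8 * (g a d * g b c - g a c * g b d)
      + 3 / 8 * ∑ s, (twoForm g (I s) a c * twoForm g (I s) d b
        + twoForm g (I s) a d * twoForm g (I s) b c))
    (fun x x' y z w => by
      simp only [twoForm, map_add, add_apply, Fin.sum_univ_three]; ring)
    (fun c x y z w => by
      simp only [twoForm, map_smul, smul_apply, smul_eq_mul, Fin.sum_univ_three]; ring)
    (fun x x' y z w => by
      simp only [twoForm, map_add, add_apply, Fin.sum_univ_three]; ring)
    (fun c x y z w => by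
      simp only [twoForm, map_smul, smul_apply, smul_eq_mul, Fin.sum_univ_three]; ring)
    (fun x x' y z w => by
      simp only [twoForm, map_add, add_apply, Fin.sum_univ_three]; ring)
    (fun c x y z w => by
      simp only [twoForm, map_smul, smul_apply, smul_eq_mul, Fin.sum_univ_three]; ring)
    (fun x x' y z w => by
      simp only [twoForm, map_add, add_apply, Fin.sum_univ_three]; ring)
    (fun c x y z w => by
      simp only [twoForm, map_smul, smul_apply, smul_eq_mul, Fin.sum_univ_three]; ring)

theorem curvTensor_apply (g : V →L[ℝ] V →L[ℝ] ℝ) (I E : Fin 3 → V →L[ℝ] V) (a b c d : V) :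
    curvTensor g I E a b c d = (∑ s, twoForm g (E s) a b * twoForm g (E s) c d)
      + 3 / 8 * (g a d * g b c - g a c * g b d)
      + 3 / 8 * ∑ s, (twoForm g (I s) a c * twoForm g (I s) d b
        + twoForm g (I s) a d * twoForm g (I s) b c) := rfl

section

variable {g : V →L[ℝ] V →L[ℝ] ℝ} {Q : Submodule ℝ (V →L[ℝ] V)} {I J E A : Fin 3 → V →L[ℝ] V}

/-- The constant part of `curvTensor` does not depend on the admissible triple, and the other part
depends only on `∑ ε_s ⊗ ε_s`. -/
theorem curvTensor_congr (hI : IsAdmissibleTriple g Q I) (hJ : IsAdmissibleTriple g Q J)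
    (h : ∀ x y z w, ∑ s, twoForm g (A s) x y * twoForm g (A s) z w
      = ∑ s, twoForm g (E s) x y * twoForm g (E s) z w) :
    curvTensor g J A = curvTensor g I E := by
  ext x y z w
  rw [curvTensor_apply, curvTensor_apply, h, Finset.sum_add_distrib, Finset.sum_add_distrib,
    hI.sum_eq hJ, hI.sum_eq hJ]

theorem twoForm_swap (hs : ∀ x y, g x y = g y x) {B : V →L[ℝ] V}
    (hB : ∀ x y, g (B x) y = -g x (B y)) (x y : V) : twoForm g B x y = -twoForm g B y x := by
  rw [twoForm, twoForm, hB, hs]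

theorem IsAdmissibleTriple.mem (hJ : IsAdmissibleTriple g Q J) (s : Fin 3) : J s ∈ Q :=
  hJ.span_eq ▸ Submodule.subset_span ⟨s, rfl⟩

theorem IsAdmissibleTriple.comm (hJ : IsAdmissibleTriple g Q J) {B : V →L[ℝ] V}
    (hB : B ∈ sp g Q) (s : Fin 3) (v : V) : B (J s v) = J s (B v) :=
  congrArg (fun A : V →L[ℝ] V => A v) (hB.2 _ (hJ.mem s))

/-- The wedge condition for one admissible triple is the wedge condition for any other. -/
theorem IsAdmissibleTriple.sum_wedge_eq (hI : IsAdmissibleTriple g Q I)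
    (hJ : IsAdmissibleTriple g Q J) (a b c d : V) :
    ∑ s, wedge (twoForm g (J s)) (twoForm g (J s)) a b c d
      = ∑ s, wedge (twoForm g (I s)) (twoForm g (I s)) a b c d := by
  have h := hI.sum_eq hJ
  simp only [wedge, Finset.sum_add_distrib, Finset.sum_sub_distrib]
  rw [h a b c d, h a c b d, h a d b c, h b c a d, h b d a c, h c d a b]

theorem sum_wedge_congr
    (h : ∀ x y z w, ∑ s, twoForm g (A s) x y * twoForm g (A s) z w
      = ∑ s, twoForm g (E s) x y * twoForm g (E s) z w) (a b c d : V) :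
    ∑ s, wedge (twoForm g (A s)) (twoForm g (A s)) a b c d
      = ∑ s, wedge (twoForm g (E s)) (twoForm g (E s)) a b c d := by
  simp only [wedge, Finset.sum_add_distrib, Finset.sum_sub_distrib]
  rw [h a b c d, h a c b d, h a d b c, h b c a d, h b d a c, h c d a b]

/-- The wedge condition is the Bianchi identity of `curvTensor`. -/
theorem curvTensor_isHyperKahlerCurvature (hs : ∀ x y, g x y = g y x)
    (hJ : IsAdmissibleTriple g Q J) (hE : ∀ s, E s ∈ sp g Q)
    (hw : ∀ a b c d, ∑ s, wedge (twoForm g (E s)) (twoForm g (E s)) a b c d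
      = -(3 / 4) * ∑ s, wedge (twoForm g (J s)) (twoForm g (J s)) a b c d) :
    IsHyperKahlerCurvature J (curvTensor g J E) := by
  have hH := hJ.hyperHermitian
  have eE : ∀ s x y, twoForm g (E s) x y = -twoForm g (E s) y x := fun s =>
    twoForm_swap hs (hE s).1
  have eJ : ∀ s x y, twoForm g (J s) x y = -twoForm g (J s) y x := fun s =>
    twoForm_swap hs (hH.skew s)
  have hK : ∀ a b c d, curvTensor g J E a b c d
      = (∑ s, twoForm g (E s) a b * twoForm g (E s) c d)
      + 3 / 8 * (g a d * g b c - g a c * g b d)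
      + 3 / 8 * ∑ s, (- twoForm g (J s) a c * twoForm g (J s) b d
        + twoForm g (J s) a d * twoForm g (J s) b c) := fun a b c d => by
    rw [curvTensor_apply]
    congr 2
    exact Finset.sum_congr rfl fun s _ => by rw [eJ s d b]; ring
  refine ⟨fun x y z w => ?_, fun x y z w => ?_, fun x y z w => ?_, fun s x y z w => ?_⟩
  · simp only [hK, fun s => eE s y x, Fin.sum_univ_three]; ring
  · simp only [hK, fun s => eE s w z, Fin.sum_univ_three]; ring
  · have h := hw x y z w
    simp only [wedge, Fin.sum_univ_three] at h
    simp only [hK, fun s => eE s z x, fun s => eJ s y x, fun s => eJ s z x, fun s => eJ s z y,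
      hs y x, hs z x, hs z y, Fin.sum_univ_three]
    linear_combination (1 / 2) * h
  · have e : ∀ t, twoForm g (E t) (J s z) (J s w) = twoForm g (E t) z w := fun t => by
      rw [twoForm, hJ.comm (hE t), hH.isometry, twoForm]
    have r : ∀ t x y, g x (J t y) = - g (J t x) y := fun t x y => by rw [hH.skew, neg_neg]
    simp only [hK, e]
    rw [add_assoc, add_assoc]
    congr 1
    simp only [twoForm, Fin.sum_univ_three]
    fin_cases s <;>
    simp only [Fin.zero_eta, Fin.mk_one, Fin.reduceFinMk, r, hH.sq_apply, hH.apply_zero_one,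
      hH.apply_one_zero, hH.apply_zero_two, hH.apply_two_zero, hH.apply_one_two,
      hH.apply_two_one, map_neg, neg_apply] <;> ring

/-- The quartic form of `curvTensor` is the sum of the squares of the moment maps
`ε_s (v, J₂ v) + i ε_s (v, J₃ v)`: the constant part does not contribute. -/
theorem symTensor_curvTensor (hs : ∀ x y, g x y = g y x) (hJ : IsHyperHermitian g J)
    (hK : IsHyperKahlerCurvature J (curvTensor g J E)) (v : V) :
    symTensor J (curvTensor g J E) (v, -J 0 v) (v, -J 0 v) (v, -J 0 v) (v, -J 0 v)
      = ∑ s, (2 * ((twoForm g (E s) v (J 1 v) : ℂ)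
          + (twoForm g (E s) v (J 2 v) : ℂ) * Complex.I)) ^ 2 := by
  have h0 : ∀ s, g v (J s v) = 0 := fun s => by
    have := hJ.skew s v v
    rw [hs] at this
    linarith
  have r : ∀ t x y, g (J t x) y = - g x (J t y) := hJ.skew
  have e : curvTensor g J E v (J 1 v) v (J 1 v) - curvTensor g J E v (J 2 v) v (J 2 v)
      = ∑ s, (twoForm g (E s) v (J 1 v) ^ 2 - twoForm g (E s) v (J 2 v) ^ 2) := by
    simp only [curvTensor_apply, Fin.sum_univ_three]
    simp only [twoForm, hJ.sq_apply, hJ.apply_zero_one, hJ.apply_zero_two,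
      hJ.apply_one_two, hJ.apply_two_one, map_neg, neg_apply, h0, hs (J _ v) v, hJ.isometry, r _ v]
    ring
  have e' : curvTensor g J E v (J 1 v) v (J 2 v)
      = ∑ s, twoForm g (E s) v (J 1 v) * twoForm g (E s) v (J 2 v) := by
    simp only [curvTensor_apply, Fin.sum_univ_three]
    simp only [twoForm, hJ.sq_apply, hJ.apply_zero_one, hJ.apply_zero_two,
      hJ.apply_one_two, hJ.apply_two_one, map_neg, neg_apply, h0, hs (J _ v) v, hJ.isometry, r _ v]
    ring
  rw [hK.symTensor_diag hJ, e, e']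
  simp only [Fin.sum_univ_three]
  push_cast
  linear_combination (-4) * ((twoForm g (E 0) v (J 2 v) : ℂ) ^ 2
    + (twoForm g (E 1) v (J 2 v) : ℂ) ^ 2 + (twoForm g (E 2) v (J 2 v) : ℂ) ^ 2) * Complex.I_sq

end

/-! ### Complex coordinates of an adapted frame -/

/-- The real vector whose projection to the `i`-eigenspace of `J₁` has the coordinates `x` in the
frame `e_α`, up to the factor `√2`. -/
def frameVec (J : Fin 3 → V →L[ℝ] V) (f : Fin 4 → V) (x : Fin 4 → ℂ) : V :=
  ∑ α, ((x α).re • f α + (x α).im • J 0 (f α))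

theorem frameVec_add (J : Fin 3 → V →L[ℝ] V) (f : Fin 4 → V) (x y : Fin 4 → ℂ) :
    frameVec J f (x + y) = frameVec J f x + frameVec J f y := by
  simp only [frameVec, Pi.add_apply, Complex.add_re, Complex.add_im, ← Finset.sum_add_distrib]
  exact Finset.sum_congr rfl fun _ _ => by module

theorem frameVec_smul (J : Fin 3 → V →L[ℝ] V) (f : Fin 4 → V) (c : ℝ) (x : Fin 4 → ℂ) :
    frameVec J f (c • x) = c • frameVec J f x := by
  simp only [frameVec, Pi.smul_apply, Complex.smul_re, Complex.smul_im, smul_eq_mul,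
    Finset.smul_sum]
  exact Finset.sum_congr rfl fun _ _ => by module

theorem frameVec_single (J : Fin 3 → V →L[ℝ] V) (f : Fin 4 → V) (β : Fin 4) (c : ℂ) :
    frameVec J f (Pi.single β c) = c.re • f β + c.im • J 0 (f β) := by
  rw [frameVec, Finset.sum_eq_single β]
  · simp
  · intro α _ h; simp [h]
  · simp

section

variable {g : V →L[ℝ] V →L[ℝ] ℝ} {Q : Submodule ℝ (V →L[ℝ] V)} {J : Fin 3 → V →L[ℝ] V}
  {f : Fin 4 → V} {A : Fin 3 → V →L[ℝ] V}

theorem sum_csmul_toW (hJ : IsHyperHermitian g J) (x : Fin 4 → ℂ) :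
    ∑ α, csmul (x α) (toW J (f α))
      = ((√2)⁻¹ • frameVec J f x, -J 0 ((√2)⁻¹ • frameVec J f x)) := by
  simp only [frameVec, Fin.sum_univ_four, csmul, toW, map_smul, map_add, Prod.mk_add_mk,
    hJ.sq_apply]
  ext <;> module

namespace IsAdaptedFrame

theorem hyperHermitian (hF : IsAdaptedFrame g Q J f) : IsHyperHermitian g J :=
  hF.triple.hyperHermitian

theorem apply_zero_frameVec (hF : IsAdaptedFrame g Q J f) (x : Fin 4 → ℂ) :
    J 0 (frameVec J f x) = frameVec J f (fun α => Complex.I * x α) := by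
  simp only [frameVec, map_sum, map_add, map_smul, hF.hyperHermitian.sq_apply]
  exact Finset.sum_congr rfl fun α _ => by
    simp only [Complex.mul_re, Complex.I_re, Complex.I_im, Complex.mul_im]; module

theorem apply_one_frameVec (hF : IsAdaptedFrame g Q J f) (x : Fin 4 → ℂ) :
    J 1 (frameVec J f x) = frameVec J f ![-star (x 2), -star (x 3), star (x 0), star (x 1)] := by
  have hJ := hF.hyperHermitian
  simp only [frameVec, Fin.sum_univ_four, map_add, map_smul, hF.three_eq, hF.four_eq, hJ.sq_apply,
    hJ.apply_one_zero, hJ.apply_zero_one, hJ.apply_one_two]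
  simp
  module

theorem apply_two_frameVec (hF : IsAdaptedFrame g Q J f) (x : Fin 4 → ℂ) :
    J 2 (frameVec J f x) = frameVec J f ![-Complex.I * star (x 2), -Complex.I * star (x 3),
      Complex.I * star (x 0), Complex.I * star (x 1)] := by
  rw [← hF.hyperHermitian.apply_zero_one, hF.apply_one_frameVec, hF.apply_zero_frameVec]
  congr 1
  ext α
  fin_cases α <;> simp

theorem inner_frameVec (hs : ∀ x y, g x y = g y x) (hF : IsAdaptedFrame g Q J f)
    (x y : Fin 4 → ℂ) :
    g (frameVec J f x) (frameVec J f y) = ∑ α, ((x α).re * (y α).re + (x α).im * (y α).im) := by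
  have h1 : ∀ α β, g (f α) (J 0 (f β)) = 0 := fun α β => by rw [hs, hF.orthogonal]
  have h2 : ∀ α β, g (J 0 (f α)) (J 0 (f β)) = if α = β then 1 else 0 := fun α β => by
    rw [hF.hyperHermitian.isometry, hF.orthonormal]
  simp only [frameVec, map_sum, map_add, map_smul, add_apply, sum_apply, smul_apply, smul_eq_mul,
    h1, h2, hF.orthonormal, hF.orthogonal, mul_ite, mul_one, mul_zero,
    Finset.sum_add_distrib, Finset.sum_ite_eq', Finset.mem_univ, if_true]
  simp [mul_comm]

/-- The coordinates of an adapted frame, as a real linear map. -/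
def coordMap (J : Fin 3 → V →L[ℝ] V) (f : Fin 4 → V) : (Fin 4 → ℂ) →ₗ[ℝ] V where
  toFun := frameVec J f
  map_add' := frameVec_add J f
  map_smul' := frameVec_smul J f

theorem injective_frameVec (hs : ∀ x y, g x y = g y x) (hF : IsAdaptedFrame g Q J f) :
    Function.Injective (coordMap J f) := by
  rw [← LinearMap.ker_eq_bot, LinearMap.ker_eq_bot']
  intro x hx
  have h := hF.inner_frameVec hs x x
  rw [show frameVec J f x = 0 from hx] at h
  simp only [map_zero] at h
  have h' := (Finset.sum_eq_zero_iff_of_nonneg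
    (fun α _ => add_nonneg (mul_self_nonneg _) (mul_self_nonneg _))).1 h.symm
  ext α
  have hα := h' α (Finset.mem_univ α)
  exact Complex.ext (by simp; nlinarith [mul_self_nonneg (x α).re, mul_self_nonneg (x α).im])
    (by simp; nlinarith [mul_self_nonneg (x α).re, mul_self_nonneg (x α).im])

variable [FiniteDimensional ℝ V]

/-- The complex coordinates of an adapted frame of an 8-dimensional space. -/
def coordEquiv (hs : ∀ x y, g x y = g y x) (hV : Module.finrank ℝ V = 8)
    (hF : IsAdaptedFrame g Q J f) : (Fin 4 → ℂ) ≃ₗ[ℝ] V :=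
  (coordMap J f).linearEquivOfInjective (hF.injective_frameVec hs)
    (by rw [hV, Module.finrank_pi_fintype]; simp)

theorem coordEquiv_apply (hs : ∀ x y, g x y = g y x) (hV : Module.finrank ℝ V = 8)
    (hF : IsAdaptedFrame g Q J f) (x : Fin 4 → ℂ) : hF.coordEquiv hs hV x = frameVec J f x := rfl

theorem exists_frameVec_eq (hs : ∀ x y, g x y = g y x) (hV : Module.finrank ℝ V = 8)
    (hF : IsAdaptedFrame g Q J f) (v : V) : ∃ x, v = frameVec J f x :=
  ⟨(hF.coordEquiv hs hV).symm v, by rw [← hF.coordEquiv_apply hs hV, LinearEquiv.apply_symm_apply]⟩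

end IsAdaptedFrame

/-! ### The irreducible representation in an adapted frame -/

/-- The endomorphisms `A_s` act on the frame by the matrices of the irreducible
representation. -/
def IsIrreducibleIn (J : Fin 3 → V →L[ℝ] V) (f : Fin 4 → V) (A : Fin 3 → V →L[ℝ] V) : Prop :=
  ∀ s x, A s (frameVec J f x) = frameVec J f ((irMatrix s).mulVec x)

theorem exists_isIrreducibleIn [T2Space V] [FiniteDimensional ℝ V] (hs : ∀ x y, g x y = g y x)
    (hV : Module.finrank ℝ V = 8) (hF : IsAdaptedFrame g Q J f) :
    ∃ A : Fin 3 → V →L[ℝ] V, IsIrreducibleIn J f A := by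
  let e := hF.coordEquiv hs hV
  refine ⟨fun s => LinearMap.toContinuousLinearMap (e.toLinearMap ∘ₗ
    ((irMatrix s).mulVecLin.restrictScalars ℝ) ∘ₗ e.symm.toLinearMap), fun s x => ?_⟩
  simp only [LinearMap.coe_toContinuousLinearMap', LinearMap.comp_apply, LinearEquiv.coe_coe,
    LinearMap.restrictScalars_apply, Matrix.mulVecLin_apply]
  rw [← hF.coordEquiv_apply hs hV x, LinearEquiv.symm_apply_apply]
  rfl

theorem irMatrix_bracket (s : Fin 3) :
    irMatrix s * irMatrix (s + 1) - irMatrix (s + 1) * irMatrix s = irMatrix (s + 2) := by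
  have h3 : ((√3 : ℝ) : ℂ) ^ 2 = 3 := by norm_cast; simp
  have hI := Complex.I_sq
  fin_cases s <;> ext i j <;> fin_cases i <;> fin_cases j <;>
    simp [irMatrix] <;> ring_nf <;> simp only [h3, hI] <;>
    ring

namespace IsIrreducibleIn

theorem bracket [FiniteDimensional ℝ V] (hs : ∀ x y, g x y = g y x)
    (hV : Module.finrank ℝ V = 8) (hF : IsAdaptedFrame g Q J f) (hA : IsIrreducibleIn J f A)
    (s : Fin 3) : A s ∘L A (s + 1) - A (s + 1) ∘L A s = A (s + 2) := by
  ext v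
  obtain ⟨x, rfl⟩ := hF.exists_frameVec_eq hs hV v
  simp only [sub_apply, ContinuousLinearMap.comp_apply, hA _ _, Matrix.mulVec_mulVec,
    ← irMatrix_bracket s, Matrix.sub_mulVec]
  rw [sub_eq_iff_eq_add, ← frameVec_add, sub_add_cancel]

theorem twoForm_zero (hs : ∀ x y, g x y = g y x) (hF : IsAdaptedFrame g Q J f)
    (hA : IsIrreducibleIn J f A) (x y : Fin 4 → ℂ) :
    twoForm g (A 0) (frameVec J f x) (frameVec J f y)
      = 3 / 2 * ((x 0).im * (y 0).re - (x 0).re * (y 0).im)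
        + 1 / 2 * ((x 1).im * (y 1).re - (x 1).re * (y 1).im)
        - 3 / 2 * ((x 2).im * (y 2).re - (x 2).re * (y 2).im)
        - 1 / 2 * ((x 3).im * (y 3).re - (x 3).re * (y 3).im) := by
  rw [twoForm, hA, hF.inner_frameVec hs]
  simp [irMatrix, Matrix.mulVec, dotProduct, Fin.sum_univ_four]
  ring

theorem twoForm_one (hs : ∀ x y, g x y = g y x) (hF : IsAdaptedFrame g Q J f)
    (hA : IsIrreducibleIn J f A) (x y : Fin 4 → ℂ) :
    twoForm g (A 1) (frameVec J f x) (frameVec J f y)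
      = √3 / 2 * (-((x 1).re * (y 0).re + (x 1).im * (y 0).im)
          + ((x 0).re * (y 1).re + (x 0).im * (y 1).im)
          - ((x 3).re * (y 2).re + (x 3).im * (y 2).im)
          + ((x 2).re * (y 3).re + (x 2).im * (y 3).im))
        + ((x 3).re * (y 1).re + (x 3).im * (y 1).im)
        - ((x 1).re * (y 3).re + (x 1).im * (y 3).im) := by
  rw [twoForm, hA, hF.inner_frameVec hs]
  simp [irMatrix, Matrix.mulVec, dotProduct, Fin.sum_univ_four]
  ring

theorem twoForm_two (hs : ∀ x y, g x y = g y x) (hF : IsAdaptedFrame g Q J f)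
    (hA : IsIrreducibleIn J f A) (x y : Fin 4 → ℂ) :
    twoForm g (A 2) (frameVec J f x) (frameVec J f y)
      = √3 / 2 * (((x 1).re * (y 0).im - (x 1).im * (y 0).re)
          + ((x 0).re * (y 1).im - (x 0).im * (y 1).re)
          - ((x 3).re * (y 2).im - (x 3).im * (y 2).re)
          - ((x 2).re * (y 3).im - (x 2).im * (y 3).re))
        - ((x 3).re * (y 1).im - (x 3).im * (y 1).re)
        - ((x 1).re * (y 3).im - (x 1).im * (y 3).re) := by
  rw [twoForm, hA, hF.inner_frameVec hs]
  simp [irMatrix, Matrix.mulVec, dotProduct, Fin.sum_univ_four]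
  ring

end IsIrreducibleIn

end

namespace IsIrreducibleIn

variable {g : V →L[ℝ] V →L[ℝ] ℝ} {Q : Submodule ℝ (V →L[ℝ] V)} {J : Fin 3 → V →L[ℝ] V}
  {f : Fin 4 → V} {A : Fin 3 → V →L[ℝ] V}

theorem mem_sp [FiniteDimensional ℝ V] (hs : ∀ x y, g x y = g y x)
    (hV : Module.finrank ℝ V = 8) (hF : IsAdaptedFrame g Q J f) (hA : IsIrreducibleIn J f A)
    (s : Fin 3) : A s ∈ sp g Q := by
  have hJ := hF.hyperHermitian
  have c0 : ∀ v, A s (J 0 v) = J 0 (A s v) := fun v => by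
    obtain ⟨x, rfl⟩ := hF.exists_frameVec_eq hs hV v
    rw [hF.apply_zero_frameVec, hA, hA, hF.apply_zero_frameVec]
    exact congrArg _ (Matrix.mulVec_smul (irMatrix s) Complex.I x)
  have c1 : ∀ v, A s (J 1 v) = J 1 (A s v) := fun v => by
    obtain ⟨x, rfl⟩ := hF.exists_frameVec_eq hs hV v
    rw [hF.apply_one_frameVec, hA, hA, hF.apply_one_frameVec]
    congr 1
    ext α
    fin_cases s <;> fin_cases α <;>
      simp [irMatrix, Matrix.mulVec, dotProduct, Fin.sum_univ_four] <;> ring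
  have c2 : ∀ v, A s (J 2 v) = J 2 (A s v) := fun v => by
    rw [← hJ.apply_zero_one, c0, c1, hJ.apply_zero_one]
  refine ⟨fun v w => ?_, fun B hB => ?_⟩
  · obtain ⟨x, rfl⟩ := hF.exists_frameVec_eq hs hV v
    obtain ⟨y, rfl⟩ := hF.exists_frameVec_eq hs hV w
    rw [hs _ (A s _)]
    change twoForm g (A s) _ _ = -twoForm g (A s) _ _
    fin_cases s
    · simp only [Fin.zero_eta, twoForm_zero hs hF hA]; ring
    · simp only [Fin.mk_one, twoForm_one hs hF hA]; ring
    · simp only [Fin.reduceFinMk, twoForm_two hs hF hA]; ring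
  · rw [← hF.triple.span_eq] at hB
    induction hB using Submodule.span_induction with
    | mem B hB =>
      obtain ⟨t, rfl⟩ := hB
      ext v
      fin_cases t
      · exact c0 v
      · exact c1 v
      · exact c2 v
    | zero => simp
    | add B C _ _ hB hC => rw [ContinuousLinearMap.comp_add, ContinuousLinearMap.add_comp, hB, hC]
    | smul c B _ hB => rw [ContinuousLinearMap.comp_smul, ContinuousLinearMap.smul_comp, hB]

/-- The three moment maps of the irreducible representation are quadratic forms whose squares add
up to the discriminant of a cubic. -/
theorem sum_sq_moment_eq_discForm (hs : ∀ x y, g x y = g y x) (hF : IsAdaptedFrame g Q J f)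
    (hA : IsIrreducibleIn J f A) (x : Fin 4 → ℂ) :
    ∑ s, ((twoForm g (A s) (frameVec J f x) (J 1 (frameVec J f x)) : ℂ)
      + (twoForm g (A s) (frameVec J f x) (J 2 (frameVec J f x)) : ℂ) * Complex.I) ^ 2
      = discForm x := by
  have h3 : ((√3 : ℝ) : ℂ) ^ 2 = 3 := by norm_cast; simp
  have m0 : ((twoForm g (A 0) (frameVec J f x) (J 1 (frameVec J f x)) : ℂ)
      + (twoForm g (A 0) (frameVec J f x) (J 2 (frameVec J f x)) : ℂ) * Complex.I)
      = Complex.I * (3 * x 0 * x 2 + x 1 * x 3) := by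
    rw [hF.apply_one_frameVec, hF.apply_two_frameVec, twoForm_zero hs hF hA,
      twoForm_zero hs hF hA]
    apply Complex.ext <;> simp <;> ring
  have m1 : ((twoForm g (A 1) (frameVec J f x) (J 1 (frameVec J f x)) : ℂ)
      + (twoForm g (A 1) (frameVec J f x) (J 2 (frameVec J f x)) : ℂ) * Complex.I)
      = -(√3 : ℝ) * x 0 * x 3 - x 1 ^ 2 + (√3 : ℝ) * x 1 * x 2 - x 3 ^ 2 := by
    rw [hF.apply_one_frameVec, hF.apply_two_frameVec, twoForm_one hs hF hA,
      twoForm_one hs hF hA]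
    apply Complex.ext <;> simp [pow_two] <;> ring
  have m2 : ((twoForm g (A 2) (frameVec J f x) (J 1 (frameVec J f x)) : ℂ)
      + (twoForm g (A 2) (frameVec J f x) (J 2 (frameVec J f x)) : ℂ) * Complex.I)
      = Complex.I * (-(√3 : ℝ) * x 0 * x 3 - x 1 ^ 2 - (√3 : ℝ) * x 1 * x 2 + x 3 ^ 2) := by
    rw [hF.apply_one_frameVec, hF.apply_two_frameVec, twoForm_two hs hF hA,
      twoForm_two hs hF hA]
    apply Complex.ext <;> simp [pow_two] <;> ring
  rw [Fin.sum_univ_three, m0, m1, m2, discForm]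
  linear_combination ((3 * x 0 * x 2 + x 1 * x 3) ^ 2 + (-(√3 : ℝ) * x 0 * x 3 - x 1 ^ 2
    - (√3 : ℝ) * x 1 * x 2 + x 3 ^ 2) ^ 2) * Complex.I_sq
    - 4 * x 0 * x 1 * x 2 * x 3 * h3

end IsIrreducibleIn

/-- The wedge identity of the irreducible representation, in the coordinates of an adapted
frame. -/
theorem IsIrreducibleIn.sum_wedge [FiniteDimensional ℝ V] {g : V →L[ℝ] V →L[ℝ] ℝ}
    {Q : Submodule ℝ (V →L[ℝ] V)} {J : Fin 3 → V →L[ℝ] V}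
    {f : Fin 4 → V} {A : Fin 3 → V →L[ℝ] V} (hs : ∀ x y, g x y = g y x)
    (hV : Module.finrank ℝ V = 8) (hF : IsAdaptedFrame g Q J f) (hA : IsIrreducibleIn J f A)
    (a b c d : V) :
    ∑ s, wedge (twoForm g (A s)) (twoForm g (A s)) a b c d
      = -(3 / 4) * ∑ s, wedge (twoForm g (J s)) (twoForm g (J s)) a b c d := by
  obtain ⟨x, rfl⟩ := hF.exists_frameVec_eq hs hV a
  obtain ⟨y, rfl⟩ := hF.exists_frameVec_eq hs hV b
  obtain ⟨z, rfl⟩ := hF.exists_frameVec_eq hs hV c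
  obtain ⟨w, rfl⟩ := hF.exists_frameVec_eq hs hV d
  have w0 : ∀ x y, twoForm g (J 0) (frameVec J f x) (frameVec J f y)
      = ((x 0).re * (y 0).im - (x 0).im * (y 0).re) + ((x 1).re * (y 1).im - (x 1).im * (y 1).re)
        + ((x 2).re * (y 2).im - (x 2).im * (y 2).re)
        + ((x 3).re * (y 3).im - (x 3).im * (y 3).re) := fun x y => by
    rw [twoForm, hF.apply_zero_frameVec, hF.inner_frameVec hs]
    simp [Fin.sum_univ_four]
    ring
  have w1 : ∀ x y, twoForm g (J 1) (frameVec J f x) (frameVec J f y)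
      = -((x 2).re * (y 0).re - (x 2).im * (y 0).im) - ((x 3).re * (y 1).re - (x 3).im * (y 1).im)
        + ((x 0).re * (y 2).re - (x 0).im * (y 2).im)
        + ((x 1).re * (y 3).re - (x 1).im * (y 3).im) := fun x y => by
    rw [twoForm, hF.apply_one_frameVec, hF.inner_frameVec hs]
    simp [Fin.sum_univ_four]
    ring
  have w2 : ∀ x y, twoForm g (J 2) (frameVec J f x) (frameVec J f y)
      = -((x 2).im * (y 0).re + (x 2).re * (y 0).im) - ((x 3).im * (y 1).re + (x 3).re * (y 1).im)
        + ((x 0).im * (y 2).re + (x 0).re * (y 2).im)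
        + ((x 1).im * (y 3).re + (x 1).re * (y 3).im) := fun x y => by
    rw [twoForm, hF.apply_two_frameVec, hF.inner_frameVec hs]
    simp [Fin.sum_univ_four]
    ring
  -- The coefficients of `√3 / 2` in the second and the third form.
  obtain ⟨P, hP⟩ : ∃ P : (Fin 4 → ℂ) → (Fin 4 → ℂ) → ℝ, ∀ x y, P x y
      = -((x 1).re * (y 0).re + (x 1).im * (y 0).im) + ((x 0).re * (y 1).re + (x 0).im * (y 1).im)
        - ((x 3).re * (y 2).re + (x 3).im * (y 2).im)
        + ((x 2).re * (y 3).re + (x 2).im * (y 3).im) := ⟨_, fun _ _ => rfl⟩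
  obtain ⟨R, hR⟩ : ∃ R : (Fin 4 → ℂ) → (Fin 4 → ℂ) → ℝ, ∀ x y, R x y
      = ((x 1).re * (y 0).im - (x 1).im * (y 0).re) + ((x 0).re * (y 1).im - (x 0).im * (y 1).re)
        - ((x 3).re * (y 2).im - (x 3).im * (y 2).re)
        - ((x 2).re * (y 3).im - (x 2).im * (y 3).re) := ⟨_, fun _ _ => rfl⟩
  have h3 : √3 ^ 2 = 3 := by simp
  simp only [Fin.sum_univ_three, wedge, w0, w1, w2, twoForm_zero hs hF hA, twoForm_one hs hF hA,
    twoForm_two hs hF hA]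
  have key := congrArg (fun r : ℝ => 1 / 2 * r * (P x y * P z w - P x z * P y w + P x w * P y z
    + (R x y * R z w - R x z * R y w + R x w * R y z))) h3
  simp only [hP, hR] at key
  generalize (x 0).re = x0, (x 0).im = x0', (x 1).re = x1, (x 1).im = x1', (x 2).re = x2,
    (x 2).im = x2', (x 3).re = x3, (x 3).im = x3', (y 0).re = y0, (y 0).im = y0', (y 1).re = y1,
    (y 1).im = y1', (y 2).re = y2, (y 2).im = y2', (y 3).re = y3, (y 3).im = y3', (z 0).re = z0,
    (z 0).im = z0', (z 1).re = z1, (z 1).im = z1', (z 2).re = z2, (z 2).im = z2', (z 3).re = z3,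
    (z 3).im = z3', (w 0).re = t0, (w 0).im = t0', (w 1).re = t1, (w 1).im = t1', (w 2).re = t2,
    (w 2).im = t2', (w 3).re = t3, (w 3).im = t3', √3 = r at key ⊢
  linear_combination key

/-! ### The cubic discriminant of the irreducible representation -/

section

variable {g : V →L[ℝ] V →L[ℝ] ℝ} {Q : Submodule ℝ (V →L[ℝ] V)} {I J : Fin 3 → V →L[ℝ] V}
  {f : Fin 4 → V} {A E : Fin 3 → V →L[ℝ] V} {K : V →ₗ[ℝ] V →ₗ[ℝ] V →ₗ[ℝ] V →ₗ[ℝ] ℝ}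
  [FiniteDimensional ℝ V]

namespace IsIrreducibleIn

theorem isHyperKahlerCurvature (hs : ∀ x y, g x y = g y x)
    (hV : Module.finrank ℝ V = 8) (hF : IsAdaptedFrame g Q J f) (hA : IsIrreducibleIn J f A) :
    IsHyperKahlerCurvature J (curvTensor g J A) :=
  curvTensor_isHyperKahlerCurvature hs hF.triple (hA.mem_sp hs hV hF) (hA.sum_wedge hs hV hF)

theorem isCubicFrame (hs : ∀ x y, g x y = g y x)
    (hV : Module.finrank ℝ V = 8) (hF : IsAdaptedFrame g Q J f) (hA : IsIrreducibleIn J f A) :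
    IsCubicFrame g Q (curvTensor g J A) J f := by
  refine ⟨hF, fun x => ?_⟩
  rw [sum_csmul_toW hF.hyperHermitian, symTensor_curvTensor hs hF.hyperHermitian
    (hA.isHyperKahlerCurvature hs hV hF), ← hA.sum_sq_moment_eq_discForm hs hF]
  refine Finset.sum_congr rfl fun s _ => ?_
  have h2 : (√2)⁻¹ * (√2)⁻¹ = (1 / 2 : ℝ) := by
    rw [← mul_inv, Real.mul_self_sqrt (by norm_num)]; norm_num
  have h : ∀ t v, twoForm g (A s) ((√2)⁻¹ • v) (J t ((√2)⁻¹ • v))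
      = 1 / 2 * twoForm g (A s) v (J t v) := fun t v => by
    simp only [twoForm, map_smul, smul_apply, smul_eq_mul, ← h2]; ring
  rw [h, h]
  push_cast
  ring

/-- A tensor with a normal frame is the one defined by the irreducible representation in this
frame. -/
theorem eq_curvTensor (hs : ∀ x y, g x y = g y x)
    (hV : Module.finrank ℝ V = 8) (hA : IsIrreducibleIn J f A) (hK : IsHyperKahlerCurvature J K)
    (hF : IsCubicFrame g Q K J f) : K = curvTensor g J A := by
  have hJ := hF.adapted.hyperHermitian
  have hK' := hA.isHyperKahlerCurvature hs hV hF.adapted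
  refine sub_eq_zero.1 ((hK.sub hK').eq_zero hJ fun v => ?_)
  obtain ⟨x, hx⟩ := hF.adapted.exists_frameVec_eq hs hV (√2 • v)
  have hv : v = (√2)⁻¹ • frameVec J f x := by
    rw [← hx, smul_smul, inv_mul_cancel₀ (by positivity), one_smul]
  have h1 := hF.normal_form x
  rw [← (hA.isCubicFrame hs hV hF.adapted).normal_form x, sum_csmul_toW hJ, ← hv,
    hK.symTensor_diag hJ, hK'.symTensor_diag hJ] at h1
  have h2 := congrArg Complex.re h1
  simp only [Complex.add_re, Complex.re_ofReal_mul, Complex.ofReal_re, Complex.I_re, mul_zero,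
    add_zero] at h2
  simp only [LinearMap.sub_apply]
  linarith

/-- The condition that defines the fibre of `Bsp(1)_ir`, in one normal frame. -/
theorem action_iff (hs : ∀ x y, g x y = g y x)
    (hV : Module.finrank ℝ V = 8) (hF : IsAdaptedFrame g Q J f) (hA : IsIrreducibleIn J f A)
    (B : V →L[ℝ] V) (a : Fin 3 → ℝ) :
    (∀ β, cmap B (toW J (f β)) = ∑ α, csmul (∑ s, (a s : ℂ) * irMatrix s α β) (toW J (f α)))
      ↔ B = ∑ s, a s • A s := by
  have hJ := hF.hyperHermitian
  have hc : (√2)⁻¹ ≠ (0 : ℝ) := by positivity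
  have hAf : ∀ β, (∑ s, a s • A s) (f β)
      = frameVec J f (fun α => ∑ s, (a s : ℂ) * irMatrix s α β) := fun β => by
    have e : f β = frameVec J f (Pi.single β 1) := by rw [frameVec_single]; simp
    have e' : (fun α => ∑ s, (a s : ℂ) * irMatrix s α β)
        = ∑ s, a s • (irMatrix s).mulVec (Pi.single β 1) := by
      ext α
      simp [Finset.sum_apply]
    rw [e', e, Fin.sum_univ_three, Fin.sum_univ_three, frameVec_add, frameVec_add, frameVec_smul,
      frameVec_smul, frameVec_smul]
    simp only [add_apply, smul_apply, hA _ _]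
  have hAJ : ∀ v, (∑ s, a s • A s) (J 0 v) = J 0 ((∑ s, a s • A s) v) := fun v => by
    simp only [Fin.sum_univ_three, add_apply, smul_apply, map_add, map_smul,
      hF.triple.comm (hA.mem_sp hs hV hF _)]
  have key : ∀ β, cmap B (toW J (f β))
      = ∑ α, csmul (∑ s, (a s : ℂ) * irMatrix s α β) (toW J (f α))
      ↔ B (f β) = (∑ s, a s • A s) (f β) ∧ B (J 0 (f β)) = (∑ s, a s • A s) (J 0 (f β)) :=
    fun β => by
    rw [sum_csmul_toW hJ (fun α => ∑ s, (a s : ℂ) * irMatrix s α β), ← hAf, hAJ]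
    simp only [cmap, toW, Prod.mk.injEq, map_smul, map_neg, neg_inj]
    exact and_congr (smul_right_injective V hc).eq_iff (smul_right_injective V hc).eq_iff
  simp only [key]
  constructor
  · intro h
    ext v
    obtain ⟨x, rfl⟩ := hF.exists_frameVec_eq hs hV v
    simp only [frameVec, map_sum, map_add, map_smul, (h _).1, (h _).2]
  · rintro rfl β
    exact ⟨rfl, rfl⟩

theorem twoForm_frame (hs : ∀ x y, g x y = g y x) (hF : IsAdaptedFrame g Q J f)
    (hA : IsIrreducibleIn J f A) (s : Fin 3) :
    twoForm g (A s) (f 0) (J 0 (f 0)) = (if s = 0 then -(3 / 2) else 0) ∧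
    twoForm g (A s) (f 0) (f 1) = (if s = 1 then √3 / 2 else 0) ∧
    twoForm g (A s) (f 0) (J 0 (f 1)) = if s = 2 then √3 / 2 else 0 := by
  have e0 : f 0 = frameVec J f (Pi.single 0 1) := by rw [frameVec_single]; simp
  have e1 : f 1 = frameVec J f (Pi.single 1 1) := by rw [frameVec_single]; simp
  have e0' : J 0 (f 0) = frameVec J f (Pi.single 0 Complex.I) := by rw [frameVec_single]; simp
  have e1' : J 0 (f 1) = frameVec J f (Pi.single 1 Complex.I) := by rw [frameVec_single]; simp
  rw [e0', e1', e0, e1]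
  fin_cases s
  · simp only [Fin.zero_eta, twoForm_zero hs hF hA]; simp
  · simp only [Fin.mk_one, twoForm_one hs hF hA]; simp
  · simp only [Fin.reduceFinMk, twoForm_two hs hF hA]; simp

theorem linearIndependent (hs : ∀ x y, g x y = g y x) (hF : IsAdaptedFrame g Q J f)
    (hA : IsIrreducibleIn J f A) : LinearIndependent ℝ A := by
  rw [Fintype.linearIndependent_iff]
  intro c hc
  have h : ∀ x y, ∑ s, c s * twoForm g (A s) x y = 0 := fun x y => by
    have := congrArg (fun B : V →L[ℝ] V => g (B x) y) hc
    simpa [twoForm] using this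
  have h3 : √3 ≠ 0 := by positivity
  have t := twoForm_frame hs hF hA
  intro s
  fin_cases s
  · simpa [fun s => (t s).1] using h (f 0) (J 0 (f 0))
  · simpa [fun s => (t s).2.1, h3] using h (f 0) (f 1)
  · simpa [fun s => (t s).2.2, h3] using h (f 0) (J 0 (f 1))

/-- The tensor `∑ ε_s ⊗ ε_s` determines the span of the `E_s`. -/
theorem span_eq (hs : ∀ x y, g x y = g y x) (hp : ∀ x, x ≠ 0 → 0 < g x x)
    (hF : IsAdaptedFrame g Q J f) (hA : IsIrreducibleIn J f A)
    (h : ∀ x y z w, ∑ s, twoForm g (A s) x y * twoForm g (A s) z w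
      = ∑ s, twoForm g (E s) x y * twoForm g (E s) z w) :
    Submodule.span ℝ (range A) = Submodule.span ℝ (range E) := by
  have hmem : ∀ x y, ∑ s, twoForm g (A s) x y • A s ∈ Submodule.span ℝ (range E) := fun x y => by
    have e : ∑ s, twoForm g (A s) x y • A s = ∑ s, twoForm g (E s) x y • E s := by
      ext z
      have hzero : ∀ w, g ((∑ s, twoForm g (A s) x y • A s) z
          - (∑ s, twoForm g (E s) x y • E s) z) w = 0 := fun w => by
        have := h x y z w
        simp only [Fin.sum_univ_three, twoForm] at this
        simp only [Fin.sum_univ_three, twoForm, map_sub, map_add, sub_apply, add_apply, smul_apply,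
          map_smul, smul_eq_mul]
        linarith
      by_contra hne
      exact (hp _ (sub_ne_zero.2 hne)).ne' (hzero _)
    rw [e]
    exact Submodule.sum_mem _ fun s _ => Submodule.smul_mem _ _ (Submodule.subset_span ⟨s, rfl⟩)
  have h3 : √3 / 2 ≠ 0 := by positivity
  have t := twoForm_frame hs hF hA
  have hle : Submodule.span ℝ (range A) ≤ Submodule.span ℝ (range E) := by
    rw [Submodule.span_le]
    rintro _ ⟨s, rfl⟩
    fin_cases s
    · have := hmem (f 0) (J 0 (f 0))
      simp only [fun s => (t s).1, ite_smul, zero_smul, Finset.sum_ite_eq', Finset.mem_univ,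
        if_true] at this
      exact (Submodule.smul_mem_iff _ (by norm_num)).1 this
    · have := hmem (f 0) (f 1)
      simp only [fun s => (t s).2.1, ite_smul, zero_smul, Finset.sum_ite_eq', Finset.mem_univ,
        if_true] at this
      exact (Submodule.smul_mem_iff _ h3).1 this
    · have := hmem (f 0) (J 0 (f 1))
      simp only [fun s => (t s).2.2, ite_smul, zero_smul, Finset.sum_ite_eq', Finset.mem_univ,
        if_true] at this
      exact (Submodule.smul_mem_iff _ h3).1 this
  have : FiniteDimensional ℝ (Submodule.span ℝ (range E)) :=
    FiniteDimensional.span_of_finite ℝ (finite_range E)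
  refine Submodule.eq_of_le_of_finrank_le hle ?_
  rw [finrank_span_eq_card (hA.linearIndependent hs hF)]
  exact finrank_range_le_card E

end IsIrreducibleIn

end

/-! ### Triples with the bracket relations of `sp(1)` -/

/-- The rows of a real matrix that are cyclically the cross products of each other, and are not
all zero, form an orthogonal matrix. -/
theorem orthogonal_of_cross {c : Matrix (Fin 3) (Fin 3) ℝ} (hne : c 0 ≠ 0)
    (h : ∀ s t, c (s + 2) t = c s (t + 1) * c (s + 1) (t + 2) - c s (t + 2) * c (s + 1) (t + 1)) :
    c.transpose * c = 1 := by
  have h00 := h 0 0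
  have h01 := h 0 1
  have h02 := h 0 2
  have h10 := h 1 0
  have h11 := h 1 1
  have h12 := h 1 2
  have h20 := h 2 0
  have h21 := h 2 1
  have h22 := h 2 2
  simp only [Fin.isValue, zero_add, Fin.reduceAdd] at h00 h01 h02 h10 h11 h12 h20 h21 h22
  have o01 : c 0 0 * c 1 0 + c 0 1 * c 1 1 + c 0 2 * c 1 2 = 0 := by
    linear_combination c 0 0 * h20 + c 0 1 * h21 + c 0 2 * h22
  have o02 : c 0 0 * c 2 0 + c 0 1 * c 2 1 + c 0 2 * c 2 2 = 0 := by
    linear_combination c 0 0 * h00 + c 0 1 * h01 + c 0 2 * h02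
  have o12 : c 1 0 * c 2 0 + c 1 1 * c 2 1 + c 1 2 * c 2 2 = 0 := by
    linear_combination c 1 0 * h00 + c 1 1 * h01 + c 1 2 * h02
  -- All rows have the squared length `det c`, and `w = u × v` gives that it is idempotent.
  obtain ⟨D, hD⟩ : ∃ D, D = c 0 0 ^ 2 + c 0 1 ^ 2 + c 0 2 ^ 2 := ⟨_, rfl⟩
  have n1 : c 1 0 ^ 2 + c 1 1 ^ 2 + c 1 2 ^ 2 = D := by
    linear_combination c 1 0 * h20 + c 1 1 * h21 + c 1 2 * h22 - hD
      - (c 0 0 * h10 + c 0 1 * h11 + c 0 2 * h12)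
  have n2 : c 2 0 ^ 2 + c 2 1 ^ 2 + c 2 2 ^ 2 = D := by
    linear_combination c 2 0 * h00 + c 2 1 * h01 + c 2 2 * h02 - hD
      - (c 0 0 * h10 + c 0 1 * h11 + c 0 2 * h12)
  have hDD : D * (D - 1) = 0 := by
    have e : c 2 0 ^ 2 + c 2 1 ^ 2 + c 2 2 ^ 2
        = (c 0 0 ^ 2 + c 0 1 ^ 2 + c 0 2 ^ 2) * (c 1 0 ^ 2 + c 1 1 ^ 2 + c 1 2 ^ 2)
          - (c 0 0 * c 1 0 + c 0 1 * c 1 1 + c 0 2 * c 1 2) ^ 2 := by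
      rw [h00, h01, h02]; ring
    rw [n2, n1, ← hD, o01] at e
    linear_combination -e
  have hD1 : D = 1 := by
    rcases mul_eq_zero.1 hDD with h0 | h1
    · refine absurd ?_ hne
      have p0 := sq_nonneg (c 0 0)
      have p1 := sq_nonneg (c 0 1)
      have p2 := sq_nonneg (c 0 2)
      have z0 : c 0 0 = 0 := pow_eq_zero_iff two_ne_zero |>.1 (by linarith)
      have z1 : c 0 1 = 0 := pow_eq_zero_iff two_ne_zero |>.1 (by linarith)
      have z2 : c 0 2 = 0 := pow_eq_zero_iff two_ne_zero |>.1 (by linarith)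
      ext t
      fin_cases t
      exacts [z0, z1, z2]
    · linarith
  have n0 : c 0 0 ^ 2 + c 0 1 ^ 2 + c 0 2 ^ 2 = 1 := by rw [← hD, hD1]
  rw [hD1] at n1 n2
  clear h00 h01 h02 h10 h11 h12 h20 h21 h22 h hDD hD hD1 hne
  refine mul_eq_one_comm.1 ?_
  ext s t
  simp only [Matrix.mul_apply, Fin.sum_univ_three, Matrix.transpose_apply, Matrix.one_apply]
  fin_cases s <;> fin_cases t <;>
    simp only [Fin.zero_eta, Fin.mk_one, Fin.reduceFinMk, Fin.isValue, Fin.reduceEq, if_true,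
      if_false] <;>
    linarith

/-- Two triples with the bracket relations of `sp(1)` and the same span differ by a rotation. -/
theorem exists_orthogonal_of_bracket {R : Type*} [Ring R] [Algebra ℝ R] {A E : Fin 3 → R}
    (hE : ∀ s, E s * E (s + 1) - E (s + 1) * E s = E (s + 2))
    (hA : ∀ s, A s * A (s + 1) - A (s + 1) * A s = A (s + 2))
    (hi : LinearIndependent ℝ A) (hm : ∀ s, A s ∈ Submodule.span ℝ (range E)) :
    ∃ c : Matrix (Fin 3) (Fin 3) ℝ, (∀ s, A s = ∑ t, c s t • E t) ∧ c.transpose * c = 1 := by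
  have hEi : LinearIndependent ℝ E := by
    rw [linearIndependent_iff_card_le_finrank_span]
    have : FiniteDimensional ℝ (Submodule.span ℝ (range E)) :=
      FiniteDimensional.span_of_finite ℝ (finite_range E)
    rw [← finrank_span_eq_card hi]
    exact Submodule.finrank_mono (Submodule.span_le.2 (by rintro _ ⟨s, rfl⟩; exact hm s))
  have hm' := fun s => (Submodule.mem_span_range_iff_exists_fun ℝ).1 (hm s)
  choose c hc using hm'
  have hc0 : c 0 ≠ 0 := fun h => hi.ne_zero 0 (by rw [← hc, h]; simp)
  refine ⟨c, fun s => (hc s).symm, orthogonal_of_cross hc0 fun s => ?_⟩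
  have h := hA s
  rw [← hc, ← hc, ← hc] at h
  simp only [Fin.sum_univ_three, mul_add, add_mul, smul_mul_smul_comm] at h
  have e0 := hE 0
  have e1 := hE 1
  have e2 := hE 2
  simp only [Fin.isValue, zero_add, Fin.reduceAdd] at e0 e1 e2
  have hz := Fintype.linearIndependent_iff.1 hEi (fun t => c (s + 2) t
    - (c s (t + 1) * c (s + 1) (t + 2) - c s (t + 2) * c (s + 1) (t + 1))) (by
      simp only [Fin.sum_univ_three, Fin.isValue, zero_add, Fin.reduceAdd]
      linear_combination (norm := module) (-1 : ℝ) • h + (c s 0 * c (s + 1) 1 - c s 1 * c (s + 1) 0) • e0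
        + (c s 1 * c (s + 1) 2 - c s 2 * c (s + 1) 1) • e1
        + (c s 2 * c (s + 1) 0 - c s 0 * c (s + 1) 2) • e2)
  exact fun t => sub_eq_zero.1 (hz t)

/-- The tensor `∑ ε_s ⊗ ε_s` depends only on the span of three endomorphisms with the bracket
relations of `sp(1)`. -/
theorem sum_twoForm_eq_of_bracket {g : V →L[ℝ] V →L[ℝ] ℝ} {A E : Fin 3 → V →L[ℝ] V}
    (hE : ∀ s, E s ∘L E (s + 1) - E (s + 1) ∘L E s = E (s + 2))
    (hA : ∀ s, A s ∘L A (s + 1) - A (s + 1) ∘L A s = A (s + 2))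
    (hi : LinearIndependent ℝ A) (hm : ∀ s, A s ∈ Submodule.span ℝ (range E)) (x y z w : V) :
    ∑ s, twoForm g (A s) x y * twoForm g (A s) z w
      = ∑ s, twoForm g (E s) x y * twoForm g (E s) z w := by
  obtain ⟨c, hc, h⟩ := exists_orthogonal_of_bracket hE hA hi hm
  have hf : ∀ s u v, twoForm g (A s) u v = ∑ t, c s t * twoForm g (E t) u v := fun s u v => by
    simp [twoForm, hc]
  have h' : ∀ p q, ∑ s, c s p * c s q = if p = q then 1 else 0 := fun p q => by
    have := congrFun (congrFun h p) q
    simpa [Matrix.mul_apply, Matrix.one_apply] using this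
  simp only [hf, Finset.sum_mul_sum]
  rw [Finset.sum_comm]
  refine Finset.sum_congr rfl fun p _ => ?_
  rw [Finset.sum_comm]
  have : ∀ q, ∑ s, c s p * twoForm g (E p) x y * (c s q * twoForm g (E q) z w)
      = (if p = q then 1 else 0) * (twoForm g (E p) x y * twoForm g (E q) z w) := fun q => by
    rw [← h', Finset.sum_mul]
    exact Finset.sum_congr rfl fun s _ => by ring
  simp [this]

/-! ### Weights -/

/-- A self-adjoint endomorphism of a nonzero finite-dimensional space has a real eigenvector. -/
theorem exists_eigenvector_of_symm {V : Type*} [AddCommGroup V] [Module ℝ V]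
    [FiniteDimensional ℝ V] [Nontrivial V] (G : V →ₗ[ℝ] V →ₗ[ℝ] ℝ) (hs : ∀ x y, G x y = G y x)
    (hp : ∀ x, x ≠ 0 → 0 < G x x) (T : V →ₗ[ℝ] V) (hT : ∀ x y, G (T x) y = G x (T y)) :
    ∃ μ : ℝ, Module.End.HasEigenvalue T μ := by
  let core : InnerProductSpace.Core ℝ V :=
    { inner := fun x y => G x y
      conj_inner_symm := fun x y => hs y x
      re_inner_nonneg := fun x => by
        by_cases h : x = 0
        · simp [h]
        · exact (hp x h).le
      add_left := fun x y z => by simp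
      smul_left := fun x y r => by simp
      definite := fun x h => by
        by_contra hx
        exact (hp x hx).ne' h }
  let _ : NormedAddCommGroup V := core.toNormedAddCommGroup
  let _ : InnerProductSpace ℝ V := InnerProductSpace.ofCore core.toCore
  have hsym : T.IsSymmetric := hT
  exact ⟨_, hsym.hasEigenvalue_iSup_of_finiteDimensional⟩

/-- `E₁, E₂, E₃` are skew-symmetric endomorphisms that commute with the hyper-Hermitian triple `J`
and satisfy the bracket relations of `sp(1)`. -/
structure IsSpOneTriple (g : V →L[ℝ] V →L[ℝ] ℝ) (J E : Fin 3 → V →L[ℝ] V) : Prop where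
  symm : ∀ x y, g x y = g y x
  pos : ∀ x, x ≠ 0 → 0 < g x x
  hyper : IsHyperHermitian g J
  skew : ∀ s x y, g (E s x) y = -g x (E s y)
  comm : ∀ s t v, E s (J t v) = J t (E s v)
  bracket : ∀ s v, E s (E (s + 1) v) - E (s + 1) (E s v) = E (s + 2) v

namespace IsSpOneTriple

variable {g : V →L[ℝ] V →L[ℝ] ℝ} {J E : Fin 3 → V →L[ℝ] V}

theorem bracket_zero (h : IsSpOneTriple g J E) (v : V) :
    E 0 (E 1 v) = E 1 (E 0 v) + E 2 v := by
  have := h.bracket 0 v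
  simp only [Fin.isValue, zero_add] at this
  rw [← this]; abel

theorem bracket_one (h : IsSpOneTriple g J E) (v : V) :
    E 1 (E 2 v) = E 2 (E 1 v) + E 0 v := by
  have := h.bracket 1 v
  simp only [Fin.isValue, Fin.reduceAdd] at this
  rw [← this]; abel

theorem bracket_two (h : IsSpOneTriple g J E) (v : V) :
    E 2 (E 0 v) = E 0 (E 2 v) + E 1 v := by
  have := h.bracket 2 v
  simp only [Fin.isValue, Fin.reduceAdd] at this
  rw [← this]; abel

theorem inner_J_self (h : IsSpOneTriple g J E) (s : Fin 3) (v : V) : g (J s v) v = 0 := by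
  have := h.hyper.skew s v v
  rw [h.symm v] at this
  linarith

/-- The wedge condition, evaluated on `v, J₁ v, J₂ v, J₃ v`: the moment map of the action has
constant length on the unit sphere. -/
theorem moment_of_wedge (h : IsSpOneTriple g J E)
    (hw : ∀ a b c d, ∑ s, wedge (twoForm g (E s)) (twoForm g (E s)) a b c d
      = -(3 / 4) * ∑ s, wedge (twoForm g (J s)) (twoForm g (J s)) a b c d) (v : V) :
    ∑ s, ∑ t, g (E s v) (J t v) ^ 2 = 9 / 4 * g v v ^ 2 := by
  have hJ := h.hyper
  have r : ∀ t x y, g (J t x) y = -g x (J t y) := hJ.skew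
  have hv : ∀ t, g v (J t v) = 0 := fun t => by rw [h.symm, h.inner_J_self]
  have hw' := hw v (J 0 v) (J 1 v) (J 2 v)
  simp only [wedge, twoForm, Fin.sum_univ_three, h.comm, r, hJ.sq_apply, hJ.apply_zero_one,
    hJ.apply_one_zero, hJ.apply_zero_two, hJ.apply_two_zero, hJ.apply_one_two,
    hJ.apply_two_one, map_neg, hv] at hw'
  simp only [Fin.sum_univ_three]
  linarith

/-- Bessel's inequality for the orthonormal vectors `J₁ v, J₂ v, J₃ v`. -/
theorem bessel (h : IsSpOneTriple g J E) {v : V} (hv : g v v = 1) (u : V) :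
    ∑ t, g u (J t v) ^ 2 ≤ g u u := by
  have hJ := h.hyper
  have hn : ∀ x, 0 ≤ g x x := fun x => by
    by_cases hx : x = 0
    · simp [hx]
    · exact (h.pos x hx).le
  have hv' : ∀ t, g v (J t v) = 0 := fun t => by rw [h.symm, h.inner_J_self]
  have r : ∀ t y, g (J t v) y = -g v (J t y) := fun t => hJ.skew t v
  have := hn (u - (g u (J 0 v) • J 0 v + g u (J 1 v) • J 1 v + g u (J 2 v) • J 2 v))
  simp only [map_sub, map_add, map_smul, sub_apply, add_apply, smul_apply, smul_eq_mul,
    h.symm (J _ v) u] at this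
  simp only [r, hJ.sq_apply, hJ.apply_zero_one,
    hJ.apply_one_zero, hJ.apply_zero_two, hJ.apply_two_zero, hJ.apply_one_two,
    hJ.apply_two_one, map_neg, hv', hv] at this
  rw [Fin.sum_univ_three]
  linarith

/-- Vectors of different weights are orthogonal. -/
theorem inner_eq_zero_of_weight (h : IsSpOneTriple g J E) {u w : V} {l m : ℝ}
    (hu : E 0 u = -(l • J 0 u)) (hw : E 0 w = -(m • J 0 w)) (hlm : l ≠ m) : g u w = 0 := by
  have h1 : g (E 0 u) (J 0 w) = -l * g u w := by
    rw [hu, map_neg, map_smul, neg_apply, smul_apply, smul_eq_mul, h.hyper.isometry]; ring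
  rw [h.skew, h.comm, hw, map_neg, map_smul, h.hyper.sq_apply, map_neg, map_smul, map_neg,
    smul_eq_mul] at h1
  have : (l - m) * g u w = 0 := by linarith
  exact (mul_eq_zero.1 this).resolve_left (sub_ne_zero.2 hlm)

theorem weight_J_zero (h : IsSpOneTriple g J E) {u : V} {l : ℝ}
    (hu : E 0 u = -(l • J 0 u)) : E 0 (J 0 u) = -(l • J 0 (J 0 u)) := by
  rw [h.comm, hu, map_neg, map_smul]

theorem weight_J_one (h : IsSpOneTriple g J E) {u : V} {l : ℝ}
    (hu : E 0 u = -(l • J 0 u)) : E 0 (J 1 u) = -((-l) • J 0 (J 1 u)) := by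
  rw [h.comm, hu, map_neg, map_smul, h.hyper.apply_one_zero, h.hyper.apply_zero_one]; module

theorem inner_two_of_weight (h : IsSpOneTriple g J E) {u w : V} {l m : ℝ}
    (hu : E 0 u = -(l • J 0 u)) (hw : E 0 w = -(m • J 0 w)) :
    g (E 2 u) w = (m - l) * g (E 1 u) (J 0 w) := by
  have h1 := congrArg (fun x => g x w) (h.bracket_zero u)
  simp only [map_add, add_apply, h.skew 0, hw, hu, map_neg, map_smul, h.comm, neg_apply,
    smul_apply, smul_eq_mul, h.hyper.skew 0] at h1
  linarith

/-- `E₂` changes weights by `± 1`. -/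
theorem inner_one_eq_zero (h : IsSpOneTriple g J E) {u w : V} {l m : ℝ}
    (hu : E 0 u = -(l • J 0 u)) (hw : E 0 w = -(m • J 0 w)) (hlm : (l - m) ^ 2 ≠ 1) :
    g (E 1 u) w = 0 := by
  have h1 := congrArg (fun x => g x w) (h.bracket_two u)
  simp only [map_add, add_apply, h.skew 0, hw, hu, map_neg, map_smul, h.comm, neg_apply,
    smul_apply, smul_eq_mul, h.hyper.skew 0] at h1
  have h2 := h.inner_two_of_weight hu (h.weight_J_zero hw)
  rw [h.hyper.sq_apply, map_neg] at h2
  have : ((l - m) ^ 2 - 1) * g (E 1 u) w = 0 := by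
    rw [h2] at h1
    linarith
  exact (mul_eq_zero.1 this).resolve_left (sub_ne_zero.2 hlm)

/-- `E₃` changes weights by `± 1`. -/
theorem inner_two_eq_zero (h : IsSpOneTriple g J E) {u w : V} {l m : ℝ}
    (hu : E 0 u = -(l • J 0 u)) (hw : E 0 w = -(m • J 0 w)) (hlm : (l - m) ^ 2 ≠ 1) :
    g (E 2 u) w = 0 := by
  rw [h.inner_two_of_weight hu hw, h.inner_one_eq_zero hu (h.weight_J_zero hw) hlm, mul_zero]

/-- For a vector of highest weight `l`, `|E₂ v|² = (l / 2) |v|²`. -/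
theorem inner_one_self (h : IsSpOneTriple g J E) {v : V} {l : ℝ}
    (hv : E 0 v = -(l • J 0 v)) (hN : E 2 v = J 0 (E 1 v)) :
    g (E 1 v) (E 1 v) = l / 2 * g v v := by
  have h1 := congrArg (fun x => g x (J 0 v)) (h.bracket_one v)
  simp only [map_add, add_apply, h.skew 1, h.skew 2, h.comm, hN, hv, h.hyper.sq_apply, map_neg,
    map_smul, neg_apply, smul_apply, smul_eq_mul, h.hyper.isometry] at h1
  rw [h.skew]
  linarith

/-- If the moment map has length `3 / 2` on the unit sphere, there is a vector of highest weight
`3 / 2`. The highest weight `l` satisfies `l² + l ≥ 9 / 4` by Bessel's inequality; thus `l ≠ 1/2`,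
and then only `E₁` contributes to the moment map of a highest weight vector, so `l² = 9 / 4`. -/
theorem exists_highest_weight [FiniteDimensional ℝ V] [Nontrivial V] (h : IsSpOneTriple g J E)
    (hm : ∀ v, ∑ s, ∑ t, g (E s v) (J t v) ^ 2 = 9 / 4 * g v v ^ 2) :
    ∃ v, g v v = 1 ∧ E 0 v = -((3 / 2 : ℝ) • J 0 v) ∧ E 2 v = J 0 (E 1 v) := by
  have hJ := h.hyper
  let T : V →ₗ[ℝ] V := (J 0 ∘L E 0 : V →L[ℝ] V)
  have hTa : ∀ x, T x = J 0 (E 0 x) := fun x => rfl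
  have hT : ∀ l v, T v = l • v ↔ E 0 v = -(l • J 0 v) := fun l v => by
    rw [hTa]
    constructor
    · intro e
      have := congrArg (J 0) e
      rw [hJ.sq_apply, map_smul] at this
      rw [← this, neg_neg]
    · intro e
      rw [e, map_neg, map_smul, hJ.sq_apply, smul_neg, neg_neg]
  obtain ⟨μ, hμ⟩ := exists_eigenvector_of_symm
    (LinearMap.mk₂ ℝ (fun x y => g x y) (by simp) (by simp) (by simp) (by simp)) h.symm h.pos T
    (fun x y => by
      simp only [LinearMap.mk₂_apply, hTa, hJ.skew, h.skew, h.comm, neg_neg])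
  obtain ⟨l, hl, hmax⟩ := (Module.End.finite_hasEigenvalue T).exists_maximal ⟨μ, hμ⟩
  have hmax' : ∀ m v, v ≠ 0 → T v = m • v → m ≤ l := fun m v hv hTv => by
    by_contra hlt
    have := hmax (Module.End.hasEigenvalue_of_hasEigenvector
      ⟨Module.End.mem_eigenspace_iff.2 hTv, hv⟩) (not_le.1 hlt).le
    exact hlt this
  obtain ⟨v₀, hv₀⟩ := hl.exists_hasEigenvector
  have hpos := h.pos v₀ hv₀.2
  obtain ⟨v, hv1, hTv⟩ : ∃ v, g v v = 1 ∧ T v = l • v := by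
    refine ⟨(√(g v₀ v₀))⁻¹ • v₀, ?_, ?_⟩
    · simp only [map_smul, smul_apply, smul_eq_mul]
      rw [← mul_assoc, ← mul_inv, Real.mul_self_sqrt hpos.le, inv_mul_cancel₀ hpos.ne']
    · rw [map_smul, hv₀.apply_eq_smul, smul_comm]
  have hv0 : v ≠ 0 := by rintro rfl; simp at hv1
  have hE : E 0 v = -(l • J 0 v) := (hT _ _).1 hTv
  -- `E₃ - J₁ E₂` raises weights by one.
  have hN : E 2 v = J 0 (E 1 v) := by
    by_contra hne
    have := hmax' (l + 1) _ (sub_ne_zero.2 hne) ((hT _ _).2 (by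
      have e1 : E 0 (E 2 v) = -(l • J 0 (E 2 v)) - E 1 v := by
        have := h.bracket_two v
        rw [hE, map_neg, map_smul, h.comm] at this
        rw [this]; abel
      have e2 : E 0 (J 0 (E 1 v)) = l • E 1 v + J 0 (E 2 v) := by
        rw [h.comm, h.bracket_zero, hE, map_neg, map_smul, h.comm, map_add, map_neg, map_smul,
          hJ.sq_apply]
        module
      rw [map_sub, e1, e2, map_sub, hJ.sq_apply]
      module))
    linarith
  have hl0 : 0 ≤ l := by
    have hne : J 1 v ≠ 0 := fun h0 => by
      have := hJ.isometry 1 v v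
      rw [h0, hv1] at this
      simp at this
    linarith [hmax' (-l) _ hne ((hT _ _).2 (h.weight_J_one hE))]
  have hv' : ∀ t, g v (J t v) = 0 := fun t => by rw [h.symm, h.inner_J_self]
  have hm0 : ∑ t, g (E 0 v) (J t v) ^ 2 = l ^ 2 := by
    simp only [Fin.sum_univ_three, hE, map_neg, map_smul, neg_apply, smul_apply, smul_eq_mul,
      hJ.skew 0 v, hJ.sq_apply, hJ.apply_zero_one, hJ.apply_zero_two, hv', hv1]
    ring
  have hmv := hm v
  rw [Fin.sum_univ_three, hm0, hv1] at hmv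
  have hE1 := h.inner_one_self hE hN
  have hE2 : g (E 2 v) (E 2 v) = l / 2 * g v v := by rw [hN, hJ.isometry, hE1]
  rw [hv1] at hE1 hE2
  have hl1 : 9 / 4 ≤ l ^ 2 + l := by
    linarith [h.bessel hv1 (E 1 v), h.bessel hv1 (E 2 v)]
  have hl2 : 1 / 2 < l := by nlinarith
  have hlm : (l - -l) ^ 2 ≠ 1 := by nlinarith
  have hll : (l - l) ^ 2 ≠ 1 := by simp
  have hJ2 : J 2 v = J 0 (J 1 v) := (hJ.apply_zero_one v).symm
  have w0 := h.weight_J_zero hE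
  have w1 := h.weight_J_one hE
  have w2 := h.weight_J_zero w1
  rw [Fin.sum_univ_three, Fin.sum_univ_three, hJ2, h.inner_one_eq_zero hE w0 hll,
    h.inner_one_eq_zero hE w1 hlm, h.inner_one_eq_zero hE w2 hlm, h.inner_two_eq_zero hE w0 hll,
    h.inner_two_eq_zero hE w1 hlm, h.inner_two_eq_zero hE w2 hlm] at hmv
  have hl3 : l = 3 / 2 := by nlinarith
  exact ⟨v, hv1, hl3 ▸ hE, hN⟩

end IsSpOneTriple

/-! ### The frame of a triple with constant moment map -/

theorem IsAdaptedFrame.eq_frameVec [FiniteDimensional ℝ V] {g : V →L[ℝ] V →L[ℝ] ℝ}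
    {Q : Submodule ℝ (V →L[ℝ] V)} {J : Fin 3 → V →L[ℝ] V} {f : Fin 4 → V}
    (hs : ∀ x y, g x y = g y x) (hV : Module.finrank ℝ V = 8) (hF : IsAdaptedFrame g Q J f)
    (v : V) : v = frameVec J f (fun α => ⟨g v (f α), g v (J 0 (f α))⟩) := by
  obtain ⟨x, rfl⟩ := hF.exists_frameVec_eq hs hV v
  congr 1
  ext α
  have e : f α = frameVec J f (Pi.single α 1) := by rw [frameVec_single]; simp
  have e' : J 0 (f α) = frameVec J f (Pi.single α Complex.I) := by rw [frameVec_single]; simp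
  rw [e', e, hF.inner_frameVec hs, hF.inner_frameVec hs]
  apply Complex.ext <;> simp [Pi.single_apply, apply_ite Complex.re, apply_ite Complex.im]

namespace IsSpOneTriple

variable {g : V →L[ℝ] V →L[ℝ] ℝ} {Q : Submodule ℝ (V →L[ℝ] V)} {J E : Fin 3 → V →L[ℝ] V}

/-- The weight frame that starts with a vector of highest weight. -/
def weightFrame (J E : Fin 3 → V →L[ℝ] V) (v : V) : Fin 4 → V :=
  ![v, (2 / √3) • E 1 v, J 1 v, J 1 ((2 / √3) • E 1 v)]

/-- The weights `3 / 2, 1 / 2, - 3 / 2, - 1 / 2` of the vectors of `weightFrame`. -/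
def weights : Fin 4 → ℝ := ![3 / 2, 1 / 2, -(3 / 2), -(1 / 2)]

theorem weight_weightFrame (h : IsSpOneTriple g J E) {v : V}
    (hv : E 0 v = -((3 / 2 : ℝ) • J 0 v)) (hN : E 2 v = J 0 (E 1 v)) (α : Fin 4) :
    E 0 (weightFrame J E v α) = -(weights α • J 0 (weightFrame J E v α)) := by
  have h1 : E 0 ((2 / √3) • E 1 v) = -((1 / 2 : ℝ) • J 0 ((2 / √3) • E 1 v)) := by
    rw [map_smul, map_smul, h.bracket_zero, hv, map_neg, map_smul, h.comm, hN]
    module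
  fin_cases α
  · exact hv
  · exact h1
  · exact h.weight_J_one hv
  · exact h.weight_J_one h1

theorem isAdaptedFrame_weightFrame (h : IsSpOneTriple g J E) (hQ : IsAdmissibleTriple g Q J)
    {v : V} (hv1 : g v v = 1) (hv : E 0 v = -((3 / 2 : ℝ) • J 0 v)) (hN : E 2 v = J 0 (E 1 v)) :
    IsAdaptedFrame g Q J (weightFrame J E v) := by
  have hw := h.weight_weightFrame hv hN
  have hwt : ∀ α β, α ≠ β → weights α ≠ weights β := by
    intro α β hαβ
    fin_cases α <;> fin_cases β <;> first | exact absurd rfl hαβ | (simp [weights]; try norm_num)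
  have h1 : g ((2 / √3) • E 1 v) ((2 / √3) • E 1 v) = 1 := by
    have h3 : (√3)⁻¹ * (√3)⁻¹ = (1 / 3 : ℝ) := by
      rw [← mul_inv, Real.mul_self_sqrt (by norm_num)]; norm_num
    simp only [map_smul, smul_apply, smul_eq_mul, h.inner_one_self hv hN, hv1]
    linear_combination 3 * h3
  refine ⟨hQ, rfl, rfl, fun α β => ?_, fun α β => ?_⟩
  · split_ifs with hαβ
    · subst hαβ
      fin_cases α
      · exact hv1
      · exact h1
      · exact (h.hyper.isometry _ _ _).trans hv1
      · exact (h.hyper.isometry _ _ _).trans h1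
    · exact h.inner_eq_zero_of_weight (hw α) (hw β) (hwt α β hαβ)
  · by_cases hαβ : α = β
    · subst hαβ
      exact h.inner_J_self _ _
    · exact h.inner_eq_zero_of_weight (h.weight_J_zero (hw α)) (hw β) (hwt α β hαβ)

/-- The length of the moment map at the second vector of the weight frame determines the size of
the remaining structure constant of the action. -/
theorem sq_add_sq_eq_one (h : IsSpOneTriple g J E) (hQ : IsAdmissibleTriple g Q J)
    (hm : ∀ v, ∑ s, ∑ t, g (E s v) (J t v) ^ 2 = 9 / 4 * g v v ^ 2)
    {v : V} (hv1 : g v v = 1) (hv : E 0 v = -((3 / 2 : ℝ) • J 0 v)) (hN : E 2 v = J 0 (E 1 v)) :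
    (4 / 3 * g (E 1 (E 1 v)) (J 1 (E 1 v))) ^ 2 + (4 / 3 * g (E 1 (E 1 v)) (J 2 (E 1 v))) ^ 2
      = 1 := by
  have hJ := h.hyper
  have hF := h.isAdaptedFrame_weightFrame hQ hv1 hv hN
  have hw : E 0 ((2 / √3) • E 1 v) = -((1 / 2 : ℝ) • J 0 ((2 / √3) • E 1 v)) :=
    h.weight_weightFrame hv hN 1
  have hn : g ((2 / √3) • E 1 v) ((2 / √3) • E 1 v) = 1 := hF.orthonormal 1 1
  have h3 : (√3)⁻¹ * (√3)⁻¹ = (1 / 3 : ℝ) := by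
    rw [← mul_inv, Real.mul_self_sqrt (by norm_num)]; norm_num
  have ha : ∀ t, g (E 1 ((2 / √3) • E 1 v)) (J t ((2 / √3) • E 1 v))
      = 4 / 3 * g (E 1 (E 1 v)) (J t (E 1 v)) := fun t => by
    simp only [map_smul, smul_apply, smul_eq_mul]
    linear_combination 4 * g (E 1 (E 1 v)) (J t (E 1 v)) * h3
  rw [← ha, ← ha]
  generalize (2 / √3) • E 1 v = u at hw hn
  have hu' : ∀ t, g u (J t u) = 0 := fun t => by rw [h.symm, h.inner_J_self]
  have w1 := h.weight_J_one hw
  have e1 := h.inner_two_of_weight hw w1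
  have e2 := h.inner_two_of_weight hw (h.weight_J_zero w1)
  rw [hJ.sq_apply, map_neg, hJ.apply_zero_one] at e2
  rw [hJ.apply_zero_one] at e1
  have hmu := hm u
  simp only [Fin.sum_univ_three, h.inner_one_eq_zero hw (h.weight_J_zero hw) (by simp),
    h.inner_two_eq_zero hw (h.weight_J_zero hw) (by simp), e1, e2, hn] at hmu
  simp only [hw, map_neg, map_smul, neg_apply, smul_apply, smul_eq_mul, hJ.skew 0 u, hJ.sq_apply,
    hJ.apply_zero_one, hJ.apply_zero_two, hu', hn] at hmu
  linarith

/-- A suitable phase of the highest weight vector normalizes the remaining structure constant. -/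
theorem exists_normalized_highest_weight [FiniteDimensional ℝ V] [Nontrivial V]
    (h : IsSpOneTriple g J E) (hQ : IsAdmissibleTriple g Q J)
    (hm : ∀ v, ∑ s, ∑ t, g (E s v) (J t v) ^ 2 = 9 / 4 * g v v ^ 2) :
    ∃ v, g v v = 1 ∧ E 0 v = -((3 / 2 : ℝ) • J 0 v) ∧ E 2 v = J 0 (E 1 v) ∧
      g (E 1 (E 1 v)) (J 1 (E 1 v)) = -(3 / 4) ∧ g (E 1 (E 1 v)) (J 2 (E 1 v)) = 0 := by
  obtain ⟨v, hv1, hv, hN⟩ := h.exists_highest_weight hm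
  have hJ := h.hyper
  have hab := h.sq_add_sq_eq_one hQ hm hv1 hv hN
  obtain ⟨a, ha⟩ : ∃ a, a = 4 / 3 * g (E 1 (E 1 v)) (J 1 (E 1 v)) := ⟨_, rfl⟩
  obtain ⟨b, hb⟩ : ∃ b, b = 4 / 3 * g (E 1 (E 1 v)) (J 2 (E 1 v)) := ⟨_, rfl⟩
  rw [← ha, ← hb] at hab
  -- The phase `z = c + i s` multiplies `a + i b` by `z²`, so `z² = - (a - i b)` makes it `-1`.
  obtain ⟨z, hz⟩ := IsAlgClosed.exists_pow_nat_eq (⟨-a, b⟩ : ℂ) two_pos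
  obtain ⟨c, s⟩ := z
  have hre : c ^ 2 - s ^ 2 = -a := by
    have := congrArg Complex.re hz
    simp only [pow_two, Complex.mul_re] at this ⊢
    exact this
  have him : 2 * c * s = b := by
    have := congrArg Complex.im hz
    simp only [pow_two, Complex.mul_im] at this
    linarith
  have hcs : c ^ 2 + s ^ 2 = 1 := by
    have : (c ^ 2 + s ^ 2) ^ 2 = 1 := by
      rw [← hab, ← him]
      linear_combination (c ^ 2 - s ^ 2 - a) * hre
    nlinarith [sq_nonneg c, sq_nonneg s]
  have hv' : ∀ t, g v (J t v) = 0 := fun t => by rw [h.symm, h.inner_J_self]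
  have hE1 : E 1 (c • v + s • J 0 v) = c • E 1 v + s • J 0 (E 1 v) := by
    rw [map_add, map_smul, map_smul, h.comm]
  refine ⟨c • v + s • J 0 v, ?_, ?_, ?_, ?_, ?_⟩
  · simp only [map_add, map_smul, add_apply, smul_apply, smul_eq_mul, hJ.isometry, h.inner_J_self,
      hv', hv1]
    linarith
  · simp only [map_add, map_smul, h.comm, hv, map_neg, hJ.sq_apply]
    module
  · rw [hE1]
    simp only [map_add, map_smul, h.comm, hN, hJ.sq_apply]
  · rw [hE1]
    simp only [map_add, map_smul, add_apply, smul_apply, smul_eq_mul, h.comm, hJ.apply_one_zero,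
      hJ.skew 0, map_neg, hJ.apply_zero_one, hJ.apply_zero_two]
    linear_combination (3 / 4) * (-(c ^ 2 - s ^ 2) * ha + 2 * c * s * hb + a * hre - b * him - hab)
  · rw [hE1]
    simp only [map_add, map_smul, add_apply, smul_apply, smul_eq_mul, h.comm, hJ.apply_two_zero,
      hJ.skew 0, map_neg, hJ.apply_zero_one, hJ.apply_zero_two]
    linear_combination (3 / 4) * (-(c ^ 2 - s ^ 2) * hb - 2 * c * s * ha + b * hre + a * him)

/-- A triple whose moment map has constant length `3 / 2` on the unit sphere acts by the matrices
of the irreducible representation in some adapted frame. -/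
theorem exists_isIrreducibleIn [FiniteDimensional ℝ V] (hV : Module.finrank ℝ V = 8)
    (h : IsSpOneTriple g J E) (hQ : IsAdmissibleTriple g Q J)
    (hm : ∀ v, ∑ s, ∑ t, g (E s v) (J t v) ^ 2 = 9 / 4 * g v v ^ 2) :
    ∃ f, IsAdaptedFrame g Q J f ∧ IsIrreducibleIn J f E := by
  have : Nontrivial V := Module.nontrivial_of_finrank_pos (R := ℝ) (by rw [hV]; norm_num)
  have hJ := h.hyper
  obtain ⟨v, hv1, hv, hN, ha, hb⟩ := h.exists_normalized_highest_weight hQ hm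
  have hF := h.isAdaptedFrame_weightFrame hQ hv1 hv hN
  have hw := h.weight_weightFrame hv hN
  refine ⟨_, hF, ?_⟩
  have h3 : √3 * √3 = 3 := Real.mul_self_sqrt (by norm_num)
  have hi3 : (√3)⁻¹ * (√3)⁻¹ = (1 / 3 : ℝ) := by
    rw [← mul_inv, h3]; norm_num
  have f1 : weightFrame J E v 1 = (2 / √3) • E 1 v := rfl
  have f3 : weightFrame J E v 3 = J 1 (weightFrame J E v 1) := rfl
  have e10 : E 1 (weightFrame J E v 0) = (√3 / 2) • weightFrame J E v 1 := by
    rw [f1, smul_smul]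
    have : √3 / 2 * (2 / √3) = 1 := by field_simp
    rw [this, one_smul]
    rfl
  have e11 : E 1 (weightFrame J E v 1)
      = -((√3 / 2) • weightFrame J E v 0) - weightFrame J E v 3 := by
    have key := hF.eq_frameVec h.symm hV (E 1 (weightFrame J E v 1))
    have i0 : g (E 1 (weightFrame J E v 1)) (weightFrame J E v 0) = -(√3 / 2) := by
      rw [h.skew, e10, map_smul, hF.orthonormal]; simp
    have i0' : g (E 1 (weightFrame J E v 1)) (J 0 (weightFrame J E v 0)) = 0 := by
      rw [h.skew, h.comm, e10, map_smul, map_smul, h.symm, hF.orthogonal]; simp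
    have i1 := h.inner_one_eq_zero (hw 1) (hw 1) (by simp)
    have i1' := h.inner_one_eq_zero (hw 1) (h.weight_J_zero (hw 1)) (by simp)
    have i2 := h.inner_one_eq_zero (hw 1) (hw 2) (by simp [weights]; norm_num)
    have i2' := h.inner_one_eq_zero (hw 1) (h.weight_J_zero (hw 2)) (by simp [weights]; norm_num)
    have i3 : g (E 1 (weightFrame J E v 1)) (weightFrame J E v 3) = -1 := by
      rw [f3, f1]
      simp only [map_smul, smul_apply, smul_eq_mul, ha]
      linear_combination (-3) * hi3
    have i3' : g (E 1 (weightFrame J E v 1)) (J 0 (weightFrame J E v 3)) = 0 := by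
      rw [f3, f1, hJ.apply_zero_one]
      simp only [map_smul, smul_apply, smul_eq_mul, hb]
      ring
    rw [key]
    simp only [frameVec, Fin.sum_univ_four, i0, i0', i1, i1', i2, i2', i3, i3']
    module
  have h0 : ∀ x, E 0 (frameVec J (weightFrame J E v) x)
      = frameVec J (weightFrame J E v) ((irMatrix 0).mulVec x) := fun x => by
    simp only [frameVec, Fin.sum_univ_four, map_add, map_smul, h.comm, hw, hJ.sq_apply, map_neg]
    simp [irMatrix, weights, Matrix.mulVec, dotProduct, Fin.sum_univ_four]
    module
  have h1 : ∀ x, E 1 (frameVec J (weightFrame J E v) x)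
      = frameVec J (weightFrame J E v) ((irMatrix 1).mulVec x) := fun x => by
    have e12 : E 1 (weightFrame J E v 2) = (√3 / 2) • weightFrame J E v 3 := by
      rw [hF.three_eq, h.comm, e10, map_smul, f3]
    have e13 : E 1 (weightFrame J E v 3)
        = -((√3 / 2) • weightFrame J E v 2) + weightFrame J E v 1 := by
      rw [f3, h.comm, e11, hF.three_eq, map_sub, map_neg, map_smul, f3, hJ.sq_apply]
      module
    simp only [frameVec, Fin.sum_univ_four, map_add, map_sub, map_smul, h.comm, e10, e11, e12, e13,
      map_neg]
    simp [irMatrix, Matrix.mulVec, dotProduct, Fin.sum_univ_four]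
    module
  intro s x
  fin_cases s
  · exact h0 x
  · exact h1 x
  · have e := irMatrix_bracket 0
    simp only [Fin.isValue, zero_add] at e
    have hb := h.bracket_zero (frameVec J (weightFrame J E v) x)
    rw [h1, h0, h0, h1, Matrix.mulVec_mulVec, Matrix.mulVec_mulVec] at hb
    simp only [Fin.reduceFinMk, ← e, Matrix.sub_mulVec]
    refine add_left_cancel (hb.symm.trans ?_)
    rw [← frameVec_add, add_sub_cancel]

end IsSpOneTriple

/-! ### Cubic discriminants at one point -/

section

variable {g : V →L[ℝ] V →L[ℝ] ℝ} {Q : Submodule ℝ (V →L[ℝ] V)} {I E : Fin 3 → V →L[ℝ] V}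
  {K : V →ₗ[ℝ] V →ₗ[ℝ] V →ₗ[ℝ] V →ₗ[ℝ] ℝ} [T2Space V] [FiniteDimensional ℝ V]

theorem mem_spOneIr_of_isIrreducibleIn (hs : ∀ x y, g x y = g y x)
    (hV : Module.finrank ℝ V = 8) {J : Fin 3 → V →L[ℝ] V} {f : Fin 4 → V}
    (hF : IsCubicFrame g Q K J f) {A : Fin 3 → V →L[ℝ] V} (hA : IsIrreducibleIn J f A)
    {B : V →L[ℝ] V} (hB : B ∈ Submodule.span ℝ (range A)) : B ∈ spOneIr g Q K := by
  obtain ⟨a, ha⟩ := (Submodule.mem_span_range_iff_exists_fun ℝ).1 hB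
  exact ⟨J, f, hF, a, (hA.action_iff hs hV hF.adapted B a).2 ha.symm⟩

/-- A cubic discriminant whose algebra `sp(1)` is spanned by the `E_s` comes from an adapted frame
with `∑ α_s ⊗ α_s = ∑ ε_s ⊗ ε_s`, where the `A_s` act irreducibly in the frame. -/
theorem exists_frame_of_spOneIr_eq (hs : ∀ x y, g x y = g y x) (hV : Module.finrank ℝ V = 8)
    (hE : ∀ s, E s ∘L E (s + 1) - E (s + 1) ∘L E s = E (s + 2))
    (hK : K ∈ cubicDiscriminants g Q)
    (hspan : spOneIr g Q K = Submodule.span ℝ (range E)) :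
    ∃ (J : Fin 3 → V →L[ℝ] V) (f : Fin 4 → V) (A : Fin 3 → V →L[ℝ] V),
      IsCubicFrame g Q K J f ∧ IsIrreducibleIn J f A ∧
      ∀ x y z w, ∑ s, twoForm g (A s) x y * twoForm g (A s) z w
        = ∑ s, twoForm g (E s) x y * twoForm g (E s) z w := by
  obtain ⟨-, J, f, hF⟩ := hK
  obtain ⟨A, hA⟩ := exists_isIrreducibleIn hs hV hF.adapted
  refine ⟨J, f, A, hF, hA, sum_twoForm_eq_of_bracket hE (hA.bracket hs hV hF.adapted)
    (hA.linearIndependent hs hF.adapted) fun s => ?_⟩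
  have := mem_spOneIr_of_isIrreducibleIn hs hV hF hA (Submodule.subset_span ⟨s, rfl⟩)
  rw [hspan] at this
  exact this

/-- Necessity of the wedge condition: it holds for the irreducible representation, and it depends
only on `∑ ε_s ⊗ ε_s`. -/
theorem wedge_of_spOneIr_eq (hs : ∀ x y, g x y = g y x) (hV : Module.finrank ℝ V = 8)
    (hE : ∀ s, E s ∘L E (s + 1) - E (s + 1) ∘L E s = E (s + 2))
    (hK : K ∈ cubicDiscriminants g Q) (hspan : spOneIr g Q K = Submodule.span ℝ (range E))
    (hI : IsAdmissibleTriple g Q I) (a b c d : V) :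
    ∑ s, wedge (twoForm g (E s)) (twoForm g (E s)) a b c d
      = -(3 / 4) * ∑ s, wedge (twoForm g (I s)) (twoForm g (I s)) a b c d := by
  obtain ⟨J, f, A, hF, hA, h⟩ := exists_frame_of_spOneIr_eq hs hV hE hK hspan
  rw [← sum_wedge_congr h, hA.sum_wedge hs hV hF.adapted, hI.sum_wedge_eq hF.adapted.triple]

/-- Uniqueness of the cubic discriminant with a given algebra `sp(1)`. -/
theorem eq_curvTensor_of_spOneIr_eq (hs : ∀ x y, g x y = g y x) (hV : Module.finrank ℝ V = 8)
    (hE : ∀ s, E s ∘L E (s + 1) - E (s + 1) ∘L E s = E (s + 2))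
    (hK : K ∈ cubicDiscriminants g Q) (hspan : spOneIr g Q K = Submodule.span ℝ (range E))
    (hI : IsAdmissibleTriple g Q I) : K = curvTensor g I E := by
  obtain ⟨J, f, A, hF, hA, h⟩ := exists_frame_of_spOneIr_eq hs hV hE hK hspan
  rw [hA.eq_curvTensor hs hV (hK.1 J hF.adapted.triple) hF,
    curvTensor_congr hI hF.adapted.triple h]

/-- The converse: the wedge condition yields an adapted frame in which the `E_s` themselves act
irreducibly. Any other normal frame gives the same tensor, hence the same algebra. -/
theorem curvTensor_mem_cubicDiscriminants (hs : ∀ x y, g x y = g y x)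
    (hp : ∀ x, x ≠ 0 → 0 < g x x) (hV : Module.finrank ℝ V = 8)
    (hE : ∀ s, E s ∘L E (s + 1) - E (s + 1) ∘L E s = E (s + 2)) (hEQ : ∀ s, E s ∈ sp g Q)
    (hI : IsAdmissibleTriple g Q I)
    (hw : ∀ a b c d, ∑ s, wedge (twoForm g (E s)) (twoForm g (E s)) a b c d
      = -(3 / 4) * ∑ s, wedge (twoForm g (I s)) (twoForm g (I s)) a b c d) :
    curvTensor g I E ∈ cubicDiscriminants g Q ∧
      spOneIr g Q (curvTensor g I E) = Submodule.span ℝ (range E) := by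
  have hT : IsSpOneTriple g I E :=
    ⟨hs, hp, hI.hyperHermitian, fun s => (hEQ s).1, fun s t v => hI.comm (hEQ s) t v,
      fun s v => congrArg (fun B : V →L[ℝ] V => B v) (hE s)⟩
  obtain ⟨f, hF, hA⟩ := hT.exists_isIrreducibleIn hV hI (hT.moment_of_wedge hw)
  have hC : IsCubicFrame g Q (curvTensor g I E) I f := hA.isCubicFrame hs hV hF
  have hHK : ∀ J, IsAdmissibleTriple g Q J → IsHyperKahlerCurvature J (curvTensor g I E) :=
    fun J hJ => by
    rw [← curvTensor_congr (A := E) (E := E) hI hJ fun _ _ _ _ => rfl]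
    exact curvTensor_isHyperKahlerCurvature hs hJ hEQ fun a b c d => by
      rw [hw, hI.sum_wedge_eq hJ]
  refine ⟨⟨hHK, I, f, hC⟩, Subset.antisymm ?_ fun B hB =>
    mem_spOneIr_of_isIrreducibleIn hs hV hC hA hB⟩
  rintro B ⟨J, f', hF', a, ha⟩
  obtain ⟨A, hA'⟩ := exists_isIrreducibleIn hs hV hF'.adapted
  have hKA := hA'.eq_curvTensor hs hV (hHK J hF'.adapted.triple) hF'
  rw [← curvTensor_congr (A := E) (E := E) hI hF'.adapted.triple fun _ _ _ _ => rfl] at hKA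
  have h : ∀ x y z w, ∑ s, twoForm g (A s) x y * twoForm g (A s) z w
      = ∑ s, twoForm g (E s) x y * twoForm g (E s) z w := fun x y z w => by
    have := congrArg (fun K : V →ₗ[ℝ] V →ₗ[ℝ] V →ₗ[ℝ] V →ₗ[ℝ] ℝ => K x y z w) hKA
    simp only [curvTensor_apply] at this
    linarith
  rw [SetLike.mem_coe, ← hA'.span_eq hs hp hF'.adapted h,
    (hA'.action_iff hs hV hF'.adapted B a).1 ha]
  exact Submodule.sum_mem _ fun s _ => Submodule.smul_mem _ _ (Submodule.subset_span ⟨s, rfl⟩)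

end

end CubicDisc

/-! ### Cubic discriminants on a manifold -/

section

variable {M : Type*} [TopologicalSpace M] [ChartedSpace E8 M]

instance (x : M) : T2Space (TangentSpace (𝓡 8) x) := inferInstanceAs (T2Space E8)

instance (x : M) : FiniteDimensional ℝ (TangentSpace (𝓡 8) x) :=
  inferInstanceAs (FiniteDimensional ℝ E8)

theorem finrank_tangentSpace_eq_eight (x : M) :
    Module.finrank ℝ (TangentSpace (𝓡 8) x) = 8 :=
  (finrank_euclideanSpace_fin : Module.finrank ℝ E8 = 8)

variable [IsManifold (𝓡 8) ∞ M]

namespace AlmostQuaternionHermitian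

variable (S : AlmostQuaternionHermitian M)

theorem contMDiffOn_inner {X Y : ∀ x : M, TangentSpace (𝓡 8) x} {U : Set M}
    (hX : SmoothVectorOn X U) (hY : SmoothVectorOn Y U) :
    ContMDiffOn (𝓡 8) 𝓘(ℝ, ℝ) ∞ (fun x => S.metric.inner x (X x) (Y x)) U := by
  have h : ContMDiffOn (𝓡 8) ((𝓡 8).prod 𝓘(ℝ, ℝ)) ∞
      (fun x => TotalSpace.mk' ℝ (E := Bundle.Trivial M ℝ) x (S.metric.inner x (X x) (Y x))) U :=
    fun x hx => ContMDiffWithinAt.clm_bundle_apply₂ (F₁ := E8) (F₂ := E8)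
      (S.metric.contMDiff.contMDiffOn x hx) (hX x hx) (hY x hx)
  intro x hx
  have hx' := h x hx
  simp only [contMDiffWithinAt_totalSpace] at hx'
  exact hx'.2

theorem contMDiffOn_form {A : EndField M} {X Y : ∀ x : M, TangentSpace (𝓡 8) x} {U : Set M}
    (hA : SmoothEndOn A U) (hX : SmoothVectorOn X U) (hY : SmoothVectorOn Y U) :
    ContMDiffOn (𝓡 8) 𝓘(ℝ, ℝ) ∞ (fun x => S.form x (A x) (X x) (Y x)) U :=
  S.contMDiffOn_inner (X := fun x => A x (X x))
    (ContMDiffOn.clm_bundle_apply (F₁ := E8) (F₂ := E8) hA hX) hY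

/-- The field of the tensors `curvTensor`, for a choice of admissible triples. -/
def curvField (E : Fin 3 → EndField M) : FourTensorField M := fun x =>
  CubicDisc.curvTensor (S.metric.inner x) (S.exists_isTripleAt x).choose (fun s => E s x)

theorem curvField_eq (E : Fin 3 → EndField M) {x : M}
    {I : Fin 3 → TangentSpace (𝓡 8) x →L[ℝ] TangentSpace (𝓡 8) x} (hI : S.IsTripleAt x I) :
    S.curvField E x = CubicDisc.curvTensor (S.metric.inner x) I (fun s => E s x) :=
  CubicDisc.curvTensor_congr hI (S.exists_isTripleAt x).choose_spec fun _ _ _ _ => rfl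

theorem smooth_curvField {E : Fin 3 → EndField M} (hE : ∀ s, SmoothEndOn (E s) univ) :
    SmoothFourTensor (S.curvField E) := by
  intro U hU X Y Z W hX hY hZ hW p hp
  obtain ⟨U', hU', hpU', I, hI, hIt⟩ := S.locally_spanned p
  refine ContMDiffAt.contMDiffWithinAt ?_
  have hN : U ∩ U' ∈ nhds p := (hU.inter hU').mem_nhds ⟨hp, hpU'⟩
  refine ContMDiffOn.contMDiffAt (s := U ∩ U') ?_ hN
  have hX' : SmoothVectorOn X (U ∩ U') := hX.mono inter_subset_left
  have hY' : SmoothVectorOn Y (U ∩ U') := hY.mono inter_subset_left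
  have hZ' : SmoothVectorOn Z (U ∩ U') := hZ.mono inter_subset_left
  have hW' : SmoothVectorOn W (U ∩ U') := hW.mono inter_subset_left
  have hI' : ∀ s, SmoothEndOn (I s) (U ∩ U') := fun s => (hI s).mono inter_subset_right
  have hE' : ∀ s, SmoothEndOn (E s) (U ∩ U') := fun s => (hE s).mono (subset_univ _)
  have hform : ∀ x ∈ U ∩ U', S.curvField E x (X x) (Y x) (Z x) (W x)
      = (∑ s, S.form x (E s x) (X x) (Y x) * S.form x (E s x) (Z x) (W x))
        + 3 / 8 * (S.metric.inner x (X x) (W x) * S.metric.inner x (Y x) (Z x)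
          - S.metric.inner x (X x) (Z x) * S.metric.inner x (Y x) (W x))
        + 3 / 8 * ∑ s, (S.form x (I s x) (X x) (Z x) * S.form x (I s x) (W x) (Y x)
          + S.form x (I s x) (X x) (W x) * S.form x (I s x) (Y x) (Z x)) := fun x hx => by
    rw [S.curvField_eq E (hIt x hx.2)]
    rfl
  refine ContMDiffOn.congr ?_ hform
  simp only [Fin.sum_univ_three]
  have c : ContMDiffOn (𝓡 8) 𝓘(ℝ, ℝ) ∞ (fun _ : M => (3 / 8 : ℝ)) (U ∩ U') := contMDiffOn_const
  have fE := fun s => (S.contMDiffOn_form (hE' s) hX' hY').mul (S.contMDiffOn_form (hE' s) hZ' hW')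
  have fI := fun s => ((S.contMDiffOn_form (hI' s) hX' hZ').mul
    (S.contMDiffOn_form (hI' s) hW' hY')).add ((S.contMDiffOn_form (hI' s) hX' hW').mul
    (S.contMDiffOn_form (hI' s) hY' hZ'))
  exact ((((fE 0).add (fE 1)).add (fE 2)).add (c.mul (((S.contMDiffOn_inner hX' hW').mul
    (S.contMDiffOn_inner hY' hZ')).sub ((S.contMDiffOn_inner hX' hZ').mul
    (S.contMDiffOn_inner hY' hW'))))).add (c.mul (((fI 0).add (fI 1)).add (fI 2)))

end AlmostQuaternionHermitian

end

end

theorem mainTheorem9 {M : Type*} [TopologicalSpace M] [ChartedSpace E8 M] [IsManifold (𝓡 8) ∞ M]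
    (S : AlmostQuaternionHermitian M) (E : Fin 3 → EndField M)
    (hE_smooth : ∀ s, SmoothEndOn (E s) univ)
    (hE_mem : ∀ s x, E s x ∈ S.Bsp2 x)
    (hE_bracket : ∀ s x, E s x ∘L E (s + 1) x - E (s + 1) x ∘L E s x = E (s + 2) x) :
    ((∃ K : FourTensorField M, S.IsCubicDiscriminant K ∧
        ∀ x, S.Bsp1ir K x = Submodule.span ℝ (range fun s => E s x)) ↔
      ∀ x a b c d, (∑ s, CubicDisc.wedge (S.form x (E s x)) (S.form x (E s x)) a b c d)
        = -(3 / 4) * S.fundamentalForm x a b c d) ∧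
    ((∀ x a b c d, (∑ s, CubicDisc.wedge (S.form x (E s x)) (S.form x (E s x)) a b c d)
        = -(3 / 4) * S.fundamentalForm x a b c d) →
      ∀ K : FourTensorField M,
        (S.IsCubicDiscriminant K ∧
          ∀ x, S.Bsp1ir K x = Submodule.span ℝ (range fun s => E s x)) ↔
        ∀ x I, S.IsTripleAt x I → ∀ a b c d, K x a b c d
          = (∑ s, S.form x (E s x) a b * S.form x (E s x) c d)
            + 3 / 8 * (S.metric.inner x a d * S.metric.inner x b c
                - S.metric.inner x a c * S.metric.inner x b d)
            + 3 / 8 * ∑ s, (S.form x (I s) a c * S.form x (I s) d b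
                + S.form x (I s) a d * S.form x (I s) b c)) := by
  have hexists : (∀ x a b c d, (∑ s, CubicDisc.wedge (S.form x (E s x)) (S.form x (E s x)) a b c d)
      = -(3 / 4) * S.fundamentalForm x a b c d) → S.IsCubicDiscriminant (S.curvField E) ∧
        ∀ x, S.Bsp1ir (S.curvField E) x = Submodule.span ℝ (range fun s => E s x) := fun hw => by
    have h := fun x => CubicDisc.curvTensor_mem_cubicDiscriminants (S.metric.symm x)
      (S.metric.pos x) (finrank_tangentSpace_eq_eight x) (fun s => hE_bracket s x)
      (fun s => hE_mem s x) (S.exists_isTripleAt x).choose_spec (hw x)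
    exact ⟨⟨S.smooth_curvField hE_smooth, fun x => (h x).1⟩, fun x => (h x).2⟩
  refine ⟨⟨?_, fun hw => ⟨_, hexists hw⟩⟩, fun hw K => ⟨?_, fun hK => ?_⟩⟩
  · rintro ⟨K, hK, hspan⟩ x a b c d
    exact CubicDisc.wedge_of_spOneIr_eq (S.metric.symm x) (finrank_tangentSpace_eq_eight x)
      (fun s => hE_bracket s x) (hK.2 x) (hspan x) (S.exists_isTripleAt x).choose_spec a b c d
  · rintro ⟨hK, hspan⟩ x I hI a b c d
    rw [CubicDisc.eq_curvTensor_of_spOneIr_eq (S.metric.symm x) (finrank_tangentSpace_eq_eight x)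
      (fun s => hE_bracket s x) (hK.2 x) (hspan x) hI]
    rfl
  · have : K = S.curvField E := by
      funext x
      obtain ⟨I, hI⟩ := S.exists_isTripleAt x
      rw [S.curvField_eq E hI]
      ext a b c d
      exact hK x I hI a b c d
    rw [this]
    exact hexists hw
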